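/- **Games.** Write $\mathbb{R}_\infty=\mathbb{R}\cup\{\pm\infty\}$ and $\mathbb{Z}_\infty=\mathbb{Z}\cup\{\pm\infty\}$. An *interval parity game* $\mathcal G$ with $M$ variables $y_1,\dots,y_M$ consists of a directed graph $(V,E)$, a partition of $V$ into positions of Player 0 and of Player 1, a finite set $\lambda(v,w)$ of labels for each edge $(v,w)$, evolution rates $a_i(v)\in\mathbb{R}$ for each position $v$ and each variable $y_i$, a payoff rule $\iota(v)=\alpha_v\cdot y_{i_v}+\beta_v$ with $\alpha_v,\beta_v\in\mathbb{R}_\infty$ for each position $v$, and a priority $\Omega(v)\in\{0,\dots,d\}$ for each position. A label $(I,\overline C,R)$ consists of an open, closed or half-open interval $I$ with endpoints in $\mathbb{R}_\infty^{\ge 0}$, constraint intervals $C_1,\dots,C_M$ with endpoints in $\mathbb{R}_\infty$, and a set $R$ of variables to reset. A state is a pair $(v,\overline y)\in V\times\mathbb{R}_\infty^M$. The state $(v',\overline y')$ is a successor of $(v,\overline y)$ if $(v,v')\in E$ and there are $(I,\overline C,R)\in\lambda(v,v')$ and $t\in I$ such that $y_i\in C_i$ for all $i$, $y'_i=0$ for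 $i\in R$, and $y'_i=y_i+a_i(v)\,t$ for $i\notin R$. The owner of the current position chooses the successor; strategies may depend on the history. A play ends when it reaches a state $(v,\overline y)$ without successors, with outcome $\alpha_v y_{i_v}+\beta_v$; an infinite play has outcome $+\infty$ if the lowest priority seen infinitely often is even, and $-\infty$ if it is odd. Player 0 maximises and Player 1 minimises. The lower value at a state is $\sup_\sigma\inf_\rho$ of the outcome over strategies $\sigma$ of Player 0 and $\rho$ of Player 1; the upper value is $\inf_\rho\sup_\sigma$. When the two agree, as they do because these games are determined, their common value is $\mathrm{val}\,\mathcal G(s)$. The game is *flat* if all rates $a_i(v)$ are $1$, and it is *over $\mathbb{Z}_\infty$* if all endpoints of the intervals $I$ and $C_i$ and all $\alpha_v,\beta_v$ are in $\mathbb{Z}_\infty$. A *counter-reset game* is a flat game in which all constraints are trivially true (every real number satisfies them) and each interval $I$ is $[0,0]$ or $[1,1]$. **Lemma.** Let $\mathcal G$ be a flat interval parity game over $\mathbb{Z}_\infty$ with a finite set $V$ of positions and $M$ variables. Suppose that $m=\max_v|\alpha_v|$ is finite and positive. Let $b\ge 0$ be an integer such that no endpoint of a constraint interval of $\mathcal G$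 other than $\infty$ exceeds $b$. For each $n\ge 1$ and each $N\in\mathbb{N}$ there are a counter-reset game $\mathcal G'$ over $\mathbb{Z}_\infty$ with finitely many positions and the same number $M$ of variables, and positions $\kappa(v,c)$ of $\mathcal G'$ for $v\in V$, $c\in\mathbb{Z}^M$, such that for each state $s=(v,\overline y)$ of $\mathcal G$ in which all $y_i$ are integers with $y_i\ge -N$, $$\left|\mathrm{val}\,\mathcal G(s)-\frac{\mathrm{val}\,\mathcal G'(s')}{n\,m}\right|\le\frac1n ,\qquad s'=\bigl(\kappa\bigl(v,(\min(y_i,b+1))_{i}\bigr),\;n\,m\cdot\overline y\bigr).$$ Here an infinite value counts as close only to itself. The inequality holds both with $\mathrm{val}$ read as the lower value of the two games and with $\mathrm{val}$ read as the upper value. -/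

import Mathlib

open Filter

noncomputable section

/-- An open, closed or half-open interval of extended reals, given by its endpoints and by
whether each endpoint is included. -/
structure ExtInterval where
  lo : EReal
  hi : EReal
  loClosed : Bool
  hiClosed : Bool

/-- The set of extended reals that lie in the interval. -/
def ExtInterval.toSet (I : ExtInterval) : Set EReal :=
  {x | I.lo ≤ x ∧ x ≤ I.hi ∧ (x = I.lo → I.loClosed = true) ∧ (x = I.hi → I.hiClosed = true)}

/-- Membership in the integers extended with `∞` and `-∞`. -/
def IsExtInt (x : EReal) : Prop :=
  x = ⊥ ∨ x = ⊤ ∨ ∃ k : ℤ, x = ((k : ℝ) : EReal)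

/-- Both endpoints are extended integers. -/
def ExtInterval.IsOverInt (I : ExtInterval) : Prop :=
  IsExtInt I.lo ∧ IsExtInt I.hi

/-- A transition label `(I, C, R)`: an interval `I` of nonnegative durations, a constraint
interval for each variable, and the set of variables that are reset. -/
structure TransLabel (M : ℕ) where
  time : ExtInterval
  time_lo_nonneg : 0 ≤ time.lo
  time_hi_nonneg : 0 ≤ time.hi
  constr : Fin M → ExtInterval
  reset : Finset (Fin M)

/-- A state: a position together with a valuation of the `M` variables. -/
abbrev GState (V : Type*) (M : ℕ) := V × (Fin M → EReal)

/-- An interval parity game with set of positions `V` and `M` variables. The labels of a pair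
`(v, w)` matter only if `edge v w` holds. A play that ends in `v` with valuation `y` has the
payoff `payMul v * y (payVar v) + payAdd v`. -/
structure IntervalParityGame (V : Type*) (M : ℕ) where
  owner : V → Fin 2
  edge : V → V → Prop
  label : V → V → Finset (TransLabel M)
  coeff : V → Fin M → ℝ
  payVar : V → Fin M
  payMul : V → EReal
  payAdd : V → EReal
  maxPrio : ℕ
  prio : V → Fin (maxPrio + 1)

namespace IntervalParityGame

variable {V : Type*} {M : ℕ}

/-- `G.Allows l s s'`: there is a transition from the position of `s` to that of `s'` carrying
the label `l`, the valuation of `s` satisfies the constraints of `l`, and `s'` arises from `s`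
by letting some time `t` in the interval of `l` pass and resetting the variables of `l`. -/
def Allows (G : IntervalParityGame V M) (l : TransLabel M) (s s' : GState V M) : Prop :=
  G.edge s.1 s'.1 ∧ l ∈ G.label s.1 s'.1 ∧ (∀ i, s.2 i ∈ (l.constr i).toSet) ∧
    (∀ i ∈ l.reset, s'.2 i = 0) ∧
    ∃ t ∈ l.time.toSet, ∀ i ∉ l.reset, s'.2 i = s.2 i + (G.coeff s.1 i : EReal) * t

/-- The set of successors of a state. -/
def succ (G : IntervalParityGame V M) (s : GState V M) : Set (GState V M) :=
  {s' | ∃ l, G.Allows l s s'}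

/-- A (history dependent) strategy of player `p`. In `σ h s`, the current state is `s`, and `h`
lists the earlier states of the play, the most recent one first. A strategy has to pick a
successor of each state of player `p` that has one; its other values are never used. -/
def Strategy (G : IntervalParityGame V M) (p : Fin 2) :=
  {σ : List (GState V M) → GState V M → GState V M //
    ∀ h s, G.owner s.1 = p → (G.succ s).Nonempty → σ h s ∈ G.succ s}

open scoped Classical in
/-- The play from `s` that is consistent with `σ` and `ρ`, as the sequence of the pairs of history
and current state. What it does after its first state without successors is irrelevant. -/
def run (G : IntervalParityGame V M) (σ : G.Strategy 0) (ρ : G.Strategy 1) (s : GState V M) :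
    ℕ → List (GState V M) × GState V M
  | 0 => ([], s)
  | k + 1 =>
    let p := G.run σ ρ s k
    (p.2 :: p.1, if G.owner p.2.1 = 0 then σ.1 p.1 p.2 else ρ.1 p.1 p.2)

/-- The payoff of a finite play ending in the state `s`. -/
def payoff (G : IntervalParityGame V M) (s : GState V M) : EReal :=
  G.payMul s.1 * s.2 (G.payVar s.1) + G.payAdd s.1

/-- The lowest priority that occurs infinitely often in a sequence of states. -/
def limPrio (G : IntervalParityGame V M) (u : ℕ → GState V M) : ℕ :=
  sInf {c | ∃ᶠ k in atTop, (G.prio (u k).1 : ℕ) = c}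

open scoped Classical in
/-- The outcome of the play from `s` under `σ` and `ρ`: the payoff of the first state without
successors if the play reaches one; otherwise `∞` or `-∞`, according to whether the lowest
priority seen infinitely often is even or odd. -/
def outcome (G : IntervalParityGame V M) (σ : G.Strategy 0) (ρ : G.Strategy 1)
    (s : GState V M) : EReal :=
  if h : ∃ k, G.succ (G.run σ ρ s k).2 = ∅ then
    G.payoff (G.run σ ρ s (Nat.find h)).2
  else if Even (G.limPrio fun k => (G.run σ ρ s k).2) then ⊤ else ⊥

/-- The highest outcome that Player 0 (the maximiser) can assure from `s`. -/
def lowerVal (G : IntervalParityGame V M) (s : GState V M) : EReal :=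
  ⨆ σ : G.Strategy 0, ⨅ ρ : G.Strategy 1, G.outcome σ ρ s

/-- The lowest outcome that Player 1 (the minimiser) can assure from `s`. -/
def upperVal (G : IntervalParityGame V M) (s : GState V M) : EReal :=
  ⨅ ρ : G.Strategy 1, ⨆ σ : G.Strategy 0, G.outcome σ ρ s

/-- All variables evolve with rate one. -/
def IsFlat (G : IntervalParityGame V M) : Prop :=
  ∀ v i, G.coeff v i = 1

/-- The game is over the extended integers: so are the endpoints of all time and constraint
intervals, and the multiplicative and additive constants of the payoffs. -/
def IsOverInt (G : IntervalParityGame V M) : Prop :=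
  (∀ v w, G.edge v w → ∀ l ∈ G.label v w,
      l.time.IsOverInt ∧ ∀ i, (l.constr i).IsOverInt) ∧
    ∀ v, IsExtInt (G.payMul v) ∧ IsExtInt (G.payAdd v)

/-- A counter-reset game: a flat game in which the constraints hold for all real valuations and
each time interval is `[0, 0]` or `[1, 1]`. -/
def IsCounterReset (G : IntervalParityGame V M) : Prop :=
  G.IsFlat ∧ ∀ v w, G.edge v w → ∀ l ∈ G.label v w,
    (∀ i, ∀ x : ℝ, (x : EReal) ∈ (l.constr i).toSet) ∧
      (l.time.toSet = {0} ∨ l.time.toSet = {1})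

/-- No endpoint of a constraint interval of the game is larger than `b`, except for `∞`. -/
def ConstraintsBoundedBy (G : IntervalParityGame V M) (b : ℕ) : Prop :=
  ∀ v w, G.edge v w → ∀ l ∈ G.label v w, ∀ i,
    ((l.constr i).lo = ⊤ ∨ (l.constr i).lo ≤ (b : EReal)) ∧
      ((l.constr i).hi = ⊤ ∨ (l.constr i).hi ≤ (b : EReal))

end IntervalParityGame

/-- The valuation given by a vector of integers, multiplied by the natural number `q`. -/
def intValuation {M : ℕ} (q : ℕ) (y : Fin M → ℤ) : Fin M → EReal :=
  fun i => (((q : ℝ) * (y i : ℝ) : ℝ) : EReal)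

/-- `|x - y| ≤ ε` for extended reals, where an infinite value is close only to itself. -/
def ExtClose (x y : EReal) (ε : ℝ) : Prop :=
  x ≤ y + (ε : EReal) ∧ y ≤ x + (ε : EReal)

end

/-! Put q = n m and call 1/q of a unit of time a tick. Split the global time, in ticks, into an
integer and a fractional part. A finite clock reading, in ticks, is then an integer `floor i` plus
the difference `now - stamp i` of two fractional parts, so it differs from that integer by less than
1. The integer changes only by resets and by the number of integer instants passed, which a
counter-reset game can count. Reading a payoff with |α| ≤ m off the counter costs at most m / q = 1
/ n.

Which moves are possible depends only on a finite region (`ClockInfo`), as for timed automata. In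
ticks, interval endpoints are multiples of q, so a constraint sees only the integer part and the
sign of `now - stamp i`, and no integer part from C = q (b + 1) on can be told apart from another.
The lower cut L = -q N loses nothing, since clocks start above it and only grow or return to 0.
Delays from equal regions can be matched so that the resulting regions are equal again
(`ClockConfig.exists_delay`).

The counter game `discretize` performs a move as a series of ticks followed by an instantaneous
finishing step. The mover owns the waiting states; their priority is bad for the mover and too large
to matter if moves keep being completed. This is a stuttering bisimulation
(`Adequate.stutterBisim`), along which strategies transfer in both directions
(`exists_right_strategy`, `exists_left_strategy`): plays match move by move, or one player waits
forever and loses. The bounds for lower and upper values follow separately, without determinacy. -/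

/-! ### Stuttering bisimulations and the transfer of strategies. -/

/-- The graph of a two-player game on the set `S` of states. -/
structure GameGraph (S : Type*) where
  owner : S → Fin 2
  succ : S → Set S

/-- The first `k` terms of a sequence, the most recent one first. -/
def history {S : Type*} (u : ℕ → S) : ℕ → List S
  | 0 => []
  | k + 1 => u k :: history u k

namespace GameGraph

variable {A B : Type*}

/-- `σ` picks a successor of each state of player `p` that has one. -/
def IsStrategy (Γ : GameGraph A) (p : Fin 2) (σ : List A → A → A) : Prop :=
  ∀ h s, Γ.owner s = p → (Γ.succ s).Nonempty → σ h s ∈ Γ.succ s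

/-- Up to its first state without successors, `u` is a play from `s` that is consistent with the
strategy `σ` of player `p`. -/
structure IsPlay (Γ : GameGraph A) (p : Fin 2) (σ : List A → A → A) (s : A) (u : ℕ → A) :
    Prop where
  zero : u 0 = s
  step : ∀ i, (∀ j ≤ i, (Γ.succ (u j)).Nonempty) →
    u (i + 1) ∈ Γ.succ (u i) ∧ (Γ.owner (u i) = p → u (i + 1) = σ (history u i) (u i))

/-- `Γ.Reach main R n x s`: there is a path from `x` through `n` states outside `main` to a state
in `main` that is related to `s`. -/
def Reach (Γ : GameGraph B) (main : B → Prop) (R : A → B → Prop) : ℕ → B → A → Prop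
  | 0, x, s => ∃ y ∈ Γ.succ x, main y ∧ R s y
  | n + 1, x, s => ∃ y ∈ Γ.succ x, ¬ main y ∧ Γ.Reach main R n y s

/-- A bisimulation in which the second game may perform a move of the first game in several steps,
which lead through states outside `main`. -/
structure StutterBisim (Γ : GameGraph A) (Δ : GameGraph B) (main : B → Prop) (R : A → B → Prop) :
    Prop where
  owner_eq : ∀ {s x}, R s x → Δ.owner x = Γ.owner s
  nonempty_iff : ∀ {s x}, R s x → ((Δ.succ x).Nonempty ↔ (Γ.succ s).Nonempty)
  back_wait : ∀ {s x y}, R s x → y ∈ Δ.succ x → ¬ main y → R s y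
  back_main : ∀ {s x y}, R s x → y ∈ Δ.succ x → main y → ∃ t ∈ Γ.succ s, R t y
  forth : ∀ {s x t}, R s x → main x → t ∈ Γ.succ s → ∃ n, Δ.Reach main R n x t

open scoped Classical in
/-- The number of moves completed in the first `k` steps of `v`. -/
noncomputable def moves (main : B → Prop) (v : ℕ → B) (k : ℕ) : ℕ :=
  Nat.count (fun j => main (v (j + 1))) k

/-- The play `v` performs the moves of the play `u`. -/
structure Match (Δ : GameGraph B) (main : B → Prop) (R : A → B → Prop) (u : ℕ → A) (v : ℕ → B) :
    Prop where
  rel : ∀ k, (∀ j < k, (Δ.succ (v j)).Nonempty) → R (u (moves main v k)) (v k)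
  frequently : (∀ j, (Δ.succ (v j)).Nonempty) → ∀ K, ∃ k ≥ K, main (v (k + 1))

/-- From some point on, `v` stays in states outside `main`, whose owner satisfies `P`. -/
def Stuck (Δ : GameGraph B) (main : B → Prop) (R : A → B → Prop) (P : Fin 2 → Prop)
    (v : ℕ → B) : Prop :=
  (∀ j, (Δ.succ (v j)).Nonempty) ∧
    ∃ K, ∀ k ≥ K, ¬ main (v (k + 1)) ∧ P (Δ.owner (v k)) ∧ ∃ s, R s (v k)

section moves

variable {main : B → Prop} {v : ℕ → B}

@[simp] theorem moves_zero : moves main v 0 = 0 := by simp [moves]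

theorem moves_succ_of_main {k : ℕ} (h : main (v (k + 1))) :
    moves main v (k + 1) = moves main v k + 1 := by
  simp [moves, Nat.count_succ, h]

theorem moves_succ_of_not_main {k : ℕ} (h : ¬ main (v (k + 1))) :
    moves main v (k + 1) = moves main v k := by
  simp [moves, Nat.count_succ, h]

theorem moves_mono : Monotone (moves main v) := by
  classical
  exact fun _ _ h => Nat.count_monotone _ h

theorem exists_moves_eq {i K : ℕ} (h : i < moves main v K) :
    ∃ k < K, moves main v k = i ∧ main (v (k + 1)) := by
  induction K with
  | zero => simp at h
  | succ K ih =>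
    by_cases hm : main (v (K + 1))
    · rw [moves_succ_of_main hm] at h
      rcases Nat.lt_succ_iff_lt_or_eq.1 h with h | h
      · obtain ⟨k, hk, h'⟩ := ih h
        exact ⟨k, by omega, h'⟩
      · exact ⟨K, by omega, h.symm, hm⟩
    · rw [moves_succ_of_not_main hm] at h
      obtain ⟨k, hk, h'⟩ := ih h
      exact ⟨k, by omega, h'⟩

theorem exists_lt_moves (h : ∀ K, ∃ k ≥ K, main (v (k + 1))) (i : ℕ) :
    ∃ K, i < moves main v K := by
  induction i with
  | zero =>
    obtain ⟨k, -, hk⟩ := h 0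
    exact ⟨k + 1, by rw [moves_succ_of_main hk]; omega⟩
  | succ i ih =>
    obtain ⟨K, hK⟩ := ih
    obtain ⟨k, hk, hm⟩ := h K
    have := moves_mono (main := main) (v := v) hk
    exact ⟨k + 1, by rw [moves_succ_of_main hm]; omega⟩

end moves

/-- Stepping along a shortest path to `t` decreases the distance whatever path is at hand, so one
positional rule per target suffices. -/
theorem exists_step_toward (Δ : GameGraph B) (main : B → Prop) (R : A → B → Prop) :
    ∃ f : A → B → B, (∀ t x, (Δ.succ x).Nonempty → f t x ∈ Δ.succ x) ∧
      ∀ t x n, Δ.Reach main R n x t →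
        (main (f t x) ∧ R t (f t x)) ∨ (¬ main (f t x) ∧ ∃ m < n, Δ.Reach main R m (f t x) t) := by
  classical
  have key : ∀ t x, ∃ y, ((Δ.succ x).Nonempty → y ∈ Δ.succ x) ∧ ∀ n, Δ.Reach main R n x t →
      (main y ∧ R t y) ∨ (¬ main y ∧ ∃ m < n, Δ.Reach main R m y t) := by
    intro t x
    by_cases h : ∃ n, Δ.Reach main R n x t
    · have h1 := Nat.find_spec h
      have h2 := fun n hn => Nat.find_min' h (m := n) hn
      generalize Nat.find h = m at h1 h2
      cases m with
      | zero =>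
        obtain ⟨y, hy, hm⟩ := h1
        exact ⟨y, fun _ => hy, fun _ _ => Or.inl hm⟩
      | succ m =>
        obtain ⟨y, hy, hm, hr⟩ := h1
        exact ⟨y, fun _ => hy, fun n hn => Or.inr ⟨hm, m, h2 n hn, hr⟩⟩
    · by_cases hx : (Δ.succ x).Nonempty
      · exact ⟨hx.some, fun _ => hx.some_mem, fun n hn => (h ⟨n, hn⟩).elim⟩
      · exact ⟨x, fun h' => (hx h').elim, fun n hn => (h ⟨n, hn⟩).elim⟩
  choose f h1 h2 using key
  exact ⟨f, h1, h2⟩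

variable {Γ : GameGraph A} {Δ : GameGraph B} {main : B → Prop} {R : A → B → Prop}

/-- A strategy for the first game carries over to the second one. -/
theorem StutterBisim.exists_right_strategy (hb : StutterBisim Γ Δ main R) {p : Fin 2}
    {σ : List A → A → A} (hσ : Γ.IsStrategy p σ) {s₀ : A} {x₀ : B} (h₀ : R s₀ x₀)
    (m₀ : main x₀) :
    ∃ τ, Δ.IsStrategy p τ ∧ ∀ v, Δ.IsPlay p τ x₀ v →
      (∃ u, Γ.IsPlay p σ s₀ u ∧ Δ.Match main R u v) ∨ Δ.Stuck main R (· ≠ p) v := by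
  classical
  obtain ⟨f, hf, hfr⟩ := exists_step_toward Δ main R
  -- The move of `Γ` credited to a completed move that ends in `y`: the choice of `σ` if it is the
  -- turn of `p` and the choice fits, otherwise any related successor.
  have hnxt : ∀ (g : List A) (s : A) (y : B), ∃ t,
      (Γ.owner s = p → R (σ g s) y → t = σ g s) ∧
      ((∃ t ∈ Γ.succ s, R t y) → t ∈ Γ.succ s ∧ R t y) := by
    intro g s y
    by_cases h : Γ.owner s = p ∧ R (σ g s) y
    · exact ⟨σ g s, fun _ _ => rfl, fun ⟨t, ht, _⟩ => ⟨hσ g s h.1 ⟨t, ht⟩, h.2⟩⟩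
    · by_cases h' : ∃ t ∈ Γ.succ s, R t y
      · exact ⟨h'.choose, fun a b => (h ⟨a, b⟩).elim, fun _ => h'.choose_spec⟩
      · exact ⟨s, fun a b => (h ⟨a, b⟩).elim, fun a => (h' a).elim⟩
  choose nxt hnxt₁ hnxt₂ using hnxt
  -- History and current state of the simulated play of `Γ`, recomputed from the states of `Δ` seen
  -- so far. They change only when `main` is reached.
  let mem : List B → List A × A := fun l => l.rec ([], s₀) fun y h m =>
    if h = [] then ([], s₀) else if main y then (m.2 :: m.1, nxt m.1 m.2 y) else m
  refine ⟨fun h x => f (σ (mem (x :: h)).1 (mem (x :: h)).2) x,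
    fun h x _ hx => hf _ x hx, fun v hv => ?_⟩
  let m : ℕ → List A × A := fun k => mem (v k :: history v k)
  have m_zero : m 0 = ([], s₀) := by simp [m, mem, history]
  have m_main : ∀ k, main (v (k + 1)) →
      m (k + 1) = ((m k).2 :: (m k).1, nxt (m k).1 (m k).2 (v (k + 1))) := by
    intro k hk
    simp [m, mem, history, hk]
  have m_wait : ∀ k, ¬ main (v (k + 1)) → m (k + 1) = m k := by
    intro k hk
    simp [m, mem, history, hk]
  have hstep : ∀ k, (∀ j ≤ k, (Δ.succ (v j)).Nonempty) → v (k + 1) ∈ Δ.succ (v k) ∧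
      (Δ.owner (v k) = p → v (k + 1) = f (σ (m k).1 (m k).2) (v k)) := hv.step
  have main_step : ∀ k, (∀ j ≤ k, (Δ.succ (v j)).Nonempty) → R (m k).2 (v k) →
      (Δ.owner (v k) = p → ∃ n, Δ.Reach main R n (v k) (σ (m k).1 (m k).2)) →
      main (v (k + 1)) → (m (k + 1)).2 ∈ Γ.succ (m k).2 ∧ R (m (k + 1)).2 (v (k + 1)) ∧
        (Γ.owner (m k).2 = p → (m (k + 1)).2 = σ (m k).1 (m k).2) := by
    intro k hk hR hr hm
    obtain ⟨h1, h2⟩ := hstep k hk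
    have h3 := hnxt₂ (m k).1 (m k).2 (v (k + 1)) (hb.back_main hR h1 hm)
    rw [m_main k hm]
    refine ⟨h3.1, h3.2, fun ho => hnxt₁ _ _ _ ho ?_⟩
    rw [← hb.owner_eq hR] at ho
    obtain ⟨n, hn⟩ := hr ho
    have := hfr _ _ _ hn
    rw [← h2 ho] at this
    rcases this with h | h
    · exact h.2
    · exact (h.1 hm).elim
  have inv : ∀ k, (∀ j < k, (Δ.succ (v j)).Nonempty) → R (m k).2 (v k) ∧
      ((Δ.succ (v k)).Nonempty → Δ.owner (v k) = p →
        ∃ n, Δ.Reach main R n (v k) (σ (m k).1 (m k).2)) := by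
    intro k
    have hmain : ∀ k, R (m k).2 (v k) → main (v k) → (Δ.succ (v k)).Nonempty →
        Δ.owner (v k) = p → ∃ n, Δ.Reach main R n (v k) (σ (m k).1 (m k).2) := by
      intro k hR hm hne ho
      rw [hb.owner_eq hR] at ho
      exact hb.forth hR hm (hσ _ _ ho ((hb.nonempty_iff hR).1 hne))
    induction k with
    | zero =>
      intro _
      have : R (m 0).2 (v 0) := by rw [m_zero, hv.zero]; exact h₀
      exact ⟨this, hmain 0 this (by rwa [hv.zero])⟩
    | succ k ih =>
      intro hk
      obtain ⟨hR, hr⟩ := ih fun j hj => hk j (by omega)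
      have hk' : ∀ j ≤ k, (Δ.succ (v j)).Nonempty := fun j hj => hk j (by omega)
      obtain ⟨h1, h2⟩ := hstep k hk'
      by_cases hm : main (v (k + 1))
      · have := (main_step k hk' hR (hr (hk' k le_rfl)) hm).2.1
        exact ⟨this, hmain _ this hm⟩
      · have hR' := hb.back_wait hR h1 hm
        rw [m_wait k hm]
        refine ⟨hR', fun _ ho => ?_⟩
        rw [hb.owner_eq hR', ← hb.owner_eq hR] at ho
        obtain ⟨n, hn⟩ := hr (hk' k le_rfl) ho
        have := hfr _ _ _ hn
        rw [← h2 ho] at this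
        rcases this with h | ⟨-, i, -, h⟩
        · exact (hm h.1).elim
        · exact ⟨i, h⟩
  by_cases hst : (∀ j, (Δ.succ (v j)).Nonempty) ∧ ∃ K, ∀ k ≥ K, ¬ main (v (k + 1))
  · right
    obtain ⟨hne, K, hK⟩ := hst
    refine ⟨hne, K, fun k hk => ⟨hK k hk, ?_, _, (inv k fun j _ => hne j).1⟩⟩
    -- Each step of `p` shortens the remaining path to the choice of `σ`, so `p` cannot be the
    -- player who waits forever.
    have no : ∀ n k, K ≤ k → Δ.owner (v k) = p →
        ¬ Δ.Reach main R n (v k) (σ (m k).1 (m k).2) := by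
      intro n
      induction n using Nat.strong_induction_on with
      | _ n ih =>
        intro k hk ho hn
        have := hfr _ _ _ hn
        rw [← (hstep k fun j _ => hne j).2 ho] at this
        rcases this with h | ⟨-, i, hi, h⟩
        · exact hK k hk h.1
        · have e := m_wait k (hK k hk)
          have o := hb.owner_eq (inv (k + 1) fun j _ => hne j).1
          rw [e, ← hb.owner_eq (inv k fun j _ => hne j).1, ho] at o
          rw [← e] at h
          exact ih i hi (k + 1) (by omega) o h
    intro ho
    obtain ⟨n, hn⟩ := (inv k fun j _ => hne j).2 (hne k) ho
    exact no n k hk ho hn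
  left
  have hfreq : (∀ j, (Δ.succ (v j)).Nonempty) → ∀ K, ∃ k ≥ K, main (v (k + 1)) := by
    intro h K
    by_contra! h'
    exact hst ⟨h, K, h'⟩
  have m_const : ∀ k d, moves main v (k + d) = moves main v k → m (k + d) = m k := by
    intro k d
    induction d with
    | zero => simp
    | succ d ih =>
      intro h
      have h1 := moves_mono (main := main) (v := v) (Nat.le_add_right k d)
      by_cases hm : main (v (k + d + 1))
      · have := moves_succ_of_main hm
        rw [← add_assoc] at h
        omega
      · rw [← add_assoc, moves_succ_of_not_main hm] at h
        rw [← add_assoc, m_wait _ hm, ih h]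
  -- The memory at the first instant with `i` completed moves; the value `s₀` is used only beyond
  -- the last completed move.
  let u : ℕ → A := fun i =>
    if h : ∃ k, moves main v k = i then (m (Nat.find h)).2 else s₀
  have hu : ∀ k, u (moves main v k) = (m k).2 := by
    intro k
    have h : ∃ j, moves main v j = moves main v k := ⟨k, rfl⟩
    obtain ⟨d, hd⟩ := Nat.exists_eq_add_of_le (Nat.find_min' h rfl)
    simp only [u, dif_pos h]
    have h1 := Nat.find_spec h
    generalize Nat.find h = a at hd h1
    subst hd
    rw [m_const a d h1.symm]
  have hhist : ∀ k, history u (moves main v k) = (m k).1 := by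
    intro k
    induction k with
    | zero => simp [m_zero, history]
    | succ k ih =>
      by_cases hm : main (v (k + 1))
      · rw [moves_succ_of_main hm, m_main k hm, history, ih, hu]
      · rw [moves_succ_of_not_main hm, m_wait k hm, ih]
  refine ⟨u, ⟨?_, fun i hi => ?_⟩, fun k hk => ?_, hfreq⟩
  · have := hu 0
    rwa [moves_zero, m_zero] at this
  -- Move `i` does get completed: otherwise `v` ends after at most `i` moves, and its counterpart on
  -- `u` has no successor, against `hi`.
  · obtain ⟨K, hK, hKne⟩ : ∃ K, i < moves main v K ∧ ∀ j < K, (Δ.succ (v j)).Nonempty := by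
      by_cases hne : ∀ j, (Δ.succ (v j)).Nonempty
      · obtain ⟨K, hK⟩ := exists_lt_moves (hfreq hne) i
        exact ⟨K, hK, fun j _ => hne j⟩
      · push Not at hne
        have h1 := Nat.find_spec hne
        have h2 : ∀ j < Nat.find hne, (Δ.succ (v j)).Nonempty := fun j hj =>
          Set.nonempty_iff_ne_empty.2 (Nat.find_min hne hj)
        generalize Nat.find hne = D at h1 h2
        refine ⟨D, ?_, h2⟩
        by_contra! hle
        have := hi _ hle
        rw [hu, ← hb.nonempty_iff (inv D h2).1, h1] at this
        exact Set.not_nonempty_empty this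
    obtain ⟨k, hk, rfl, hm⟩ := exists_moves_eq hK
    have hk' : ∀ j ≤ k, (Δ.succ (v j)).Nonempty := fun j hj => hKne j (by omega)
    obtain ⟨hR, hr⟩ := inv k fun j hj => hk' j hj.le
    have := main_step k hk' hR (hr (hk' k le_rfl)) hm
    rw [← moves_succ_of_main hm, hu, hu, hhist]
    exact ⟨this.1, this.2.2⟩
  · rw [hu]
    exact (inv k hk).1

/-- A strategy for the second game carries over to the first one. -/
theorem StutterBisim.exists_left_strategy (hb : StutterBisim Γ Δ main R) {p : Fin 2}
    {τ : List B → B → B} (hτ : Δ.IsStrategy p τ) {s₀ : A} {x₀ : B} (h₀ : R s₀ x₀)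
    (m₀ : main x₀) :
    ∃ σ, Γ.IsStrategy p σ ∧ ∀ u, Γ.IsPlay p σ s₀ u →
      ∃ v, Δ.IsPlay p τ x₀ v ∧ (Δ.Match main R u v ∨ Δ.Stuck main R (· = p) v) := by
  classical
  obtain ⟨f, hf, hfr⟩ := exists_step_toward Δ main R
  have hpick : ∀ (s : A) (y : B), ∃ t, ((Γ.succ s).Nonempty → t ∈ Γ.succ s) ∧
      ((∃ t ∈ Γ.succ s, R t y) → R t y) := by
    intro s y
    by_cases h : ∃ t ∈ Γ.succ s, R t y
    · exact ⟨h.choose, fun _ => h.choose_spec.1, fun _ => h.choose_spec.2⟩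
    · by_cases hs : (Γ.succ s).Nonempty
      · exact ⟨hs.some, fun _ => hs.some_mem, fun h' => (h h').elim⟩
      · exact ⟨s, fun h' => (hs h').elim, fun h' => (h h').elim⟩
  choose pick hpick₁ hpick₂ using hpick
  -- One step of `Δ` within the move from `s` to `t`: `τ` decides for `p`, while the opponent is
  -- made to head for `t`.
  let micro : A → A → List B × B → List B × B := fun s t y =>
    (y.2 :: y.1, if Γ.owner s = p then τ y.1 y.2 else f t y.2)
  -- Iterates `micro` up to the next state in `main`; the default stands for a move that is never
  -- completed.
  let adv : A → A → List B × B → List B × B := fun s t y =>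
    if h : ∃ n, main ((micro s t)^[n + 1] y).2 then (micro s t)^[Nat.find h + 1] y else ([], x₀)
  have adv_main : ∀ s t y, main (micro s t y).2 → adv s t y = micro s t y := by
    intro s t y h
    have h' : ∃ n, main ((micro s t)^[n + 1] y).2 := ⟨0, h⟩
    have h0 : Nat.find h' = 0 := (Nat.find_eq_zero h').2 h
    simp only [adv, dif_pos h', h0]
    rfl
  have adv_wait : ∀ s t y, ¬ main (micro s t y).2 → adv s t (micro s t y) = adv s t y := by
    intro s t y h
    by_cases h' : ∃ n, main ((micro s t)^[n + 1] (micro s t y)).2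
    · have h'' : ∃ n, main ((micro s t)^[n + 1] y).2 := ⟨h'.choose + 1, h'.choose_spec⟩
      have e : Nat.find h'' = Nat.find h' + 1 := Nat.find_comp_succ h'' h' h
      simp only [adv, dif_pos h', dif_pos h'', e]
      rfl
    · have h'' : ¬ ∃ n, main ((micro s t)^[n + 1] y).2 := by
        rintro ⟨n, hn⟩
        cases n with
        | zero => exact h hn
        | succ n => exact h' ⟨n, hn⟩
      simp only [adv, dif_neg h', dif_neg h'']
  -- On the turn of `p` the target is ignored, so the end of the move can be computed before its
  -- target is chosen. This justifies the dummy target in `adv s s` below.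
  have adv_congr : ∀ s t t' y, Γ.owner s = p → adv s t y = adv s t' y := by
    intro s t t' y h
    have : micro s t = micro s t' := by simp [micro, h]
    simp only [adv, this]
  let mem : List A → List B × B := fun l => l.rec ([], x₀) fun t h m =>
    h.head?.elim ([], x₀) fun s => adv s t m
  refine ⟨fun h s => pick s (adv s s (mem (s :: h))).2, fun h s _ hs => hpick₁ _ _ hs,
    fun u hu => ?_⟩
  let m : ℕ → List B × B := fun i => mem (u i :: history u i)
  have m_zero : m 0 = ([], x₀) := by simp [m, mem, history]
  have m_succ : ∀ i, m (i + 1) = adv (u i) (u (i + 1)) (m i) := by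
    intro i
    simp [m, mem, history]
  have hstep : ∀ i, (∀ j ≤ i, (Γ.succ (u j)).Nonempty) → u (i + 1) ∈ Γ.succ (u i) ∧
      (Γ.owner (u i) = p → u (i + 1) = pick (u i) (adv (u i) (u i) (m i)).2) := hu.step
  -- The play of `Δ` with its history, and the index in `u` of the move in progress.
  let z : ℕ → (List B × B) × ℕ := fun k => k.rec (([], x₀), 0) fun _ w =>
    (micro (u w.2) (u (w.2 + 1)) w.1,
      if main (micro (u w.2) (u (w.2 + 1)) w.1).2 then w.2 + 1 else w.2)
  let v : ℕ → B := fun k => (z k).1.2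
  have z_snd : ∀ k, (z k).2 = moves main v k := by
    intro k
    induction k with
    | zero => simp [z]
    | succ k ih =>
      by_cases hm : main (v (k + 1))
      · rw [moves_succ_of_main hm, ← ih]
        exact if_pos hm
      · rw [moves_succ_of_not_main hm, ← ih]
        exact if_neg hm
  have z_succ : ∀ k, (z (k + 1)).1 =
      micro (u (moves main v k)) (u (moves main v k + 1)) (z k).1 := by
    intro k
    rw [← z_snd]
  have z_hist : ∀ k, (z k).1.1 = history v k := by
    intro k
    induction k with
    | zero => rfl
    | succ k ih => rw [z_succ, history, ← ih]
  have v_succ : ∀ k, v (k + 1) = if Γ.owner (u (moves main v k)) = p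
      then τ (history v k) (v k) else f (u (moves main v k + 1)) (v k) := by
    intro k
    change (z (k + 1)).1.2 = _
    rw [z_succ, ← z_hist]
  have v_mem : ∀ k, (Δ.succ (v k)).Nonempty → R (u (moves main v k)) (v k) →
      v (k + 1) ∈ Δ.succ (v k) := by
    intro k hk hR
    rw [v_succ]
    split_ifs with ho
    · exact hτ _ _ (by rw [hb.owner_eq hR, ho]) hk
    · exact hf _ _ hk
  -- The third conjunct ties the step-by-step play to the memory of the strategy: completing the
  -- move from the present intermediate state gives the same result as completing it from its start.
  have inv : ∀ k, (∀ j < k, (Δ.succ (v j)).Nonempty) →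
      R (u (moves main v k)) (v k) ∧
      (∀ j < moves main v k, (Γ.succ (u j)).Nonempty) ∧
      adv (u (moves main v k)) (u (moves main v k + 1)) (z k).1 = m (moves main v k + 1) ∧
      ((Δ.succ (v k)).Nonempty → Γ.owner (u (moves main v k)) ≠ p →
        ∃ n, Δ.Reach main R n (v k) (u (moves main v k + 1))) := by
    intro k
    induction k with
    | zero =>
      intro _
      have hR : R (u 0) (v 0) := by rw [hu.zero]; exact h₀
      simp only [moves_zero]
      refine ⟨hR, by simp, ?_, fun hne _ => ?_⟩
      · rw [m_succ, m_zero]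
        rfl
      · refine hb.forth hR m₀ (hstep 0 fun j hj => ?_).1
        rw [Nat.le_zero.1 hj]
        exact (hb.nonempty_iff hR).1 hne
    | succ k ih =>
      intro hk
      obtain ⟨hR, hne, hadv, hr⟩ := ih fun j hj => hk j (by omega)
      have hvk := hk k (by omega)
      have hvs := v_mem k hvk hR
      have hne' : ∀ j ≤ moves main v k, (Γ.succ (u j)).Nonempty := by
        intro j hj
        rcases hj.lt_or_eq with h | rfl
        · exact hne j h
        · exact (hb.nonempty_iff hR).1 hvk
      obtain ⟨hu₁, hu₂⟩ := hstep _ hne'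
      have hfv : Γ.owner (u (moves main v k)) ≠ p →
          v (k + 1) = f (u (moves main v k + 1)) (v k) := by
        intro ho
        rw [v_succ, if_neg ho]
      by_cases hm : main (v (k + 1))
      · rw [moves_succ_of_main hm]
        have hz : (z (k + 1)).1 = m (moves main v k + 1) := by
          rw [← hadv, adv_main]
          · exact z_succ k
          · rw [← z_succ]
            exact hm
        have hR' : R (u (moves main v k + 1)) (v (k + 1)) := by
          by_cases ho : Γ.owner (u (moves main v k)) = p
          · rw [hu₂ ho]
            have : (adv (u (moves main v k)) (u (moves main v k)) (m (moves main v k))).2 =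
                v (k + 1) := by
              rw [adv_congr _ _ (u (moves main v k + 1)) _ ho, ← m_succ, ← hz]
            rw [this]
            exact hpick₂ _ _ (hb.back_main hR hvs hm)
          · obtain ⟨n, hn⟩ := hr hvk ho
            have := hfr _ _ _ hn
            rw [← hfv ho] at this
            rcases this with h | h
            · exact h.2
            · exact (h.1 hm).elim
        refine ⟨hR', fun j hj => hne' j (by omega), by rw [hz, ← m_succ], fun hn _ => ?_⟩
        refine hb.forth hR' hm (hstep _ fun j hj => ?_).1
        rcases hj.lt_or_eq with h | rfl
        · exact hne' j (by omega)
        · exact (hb.nonempty_iff hR').1 hn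
      · rw [moves_succ_of_not_main hm]
        refine ⟨hb.back_wait hR hvs hm, hne, ?_, fun _ ho => ?_⟩
        · rw [z_succ, adv_wait, hadv]
          rw [← z_succ]
          exact hm
        · obtain ⟨n, hn⟩ := hr hvk ho
          have := hfr _ _ _ hn
          rw [← hfv ho] at this
          rcases this with h | ⟨-, i, -, h⟩
          · exact (hm h.1).elim
          · exact ⟨i, h⟩
  refine ⟨v, ⟨rfl, fun k hk => ?_⟩, ?_⟩
  · obtain ⟨hR, -⟩ := inv k fun j hj => hk j hj.le
    refine ⟨v_mem k (hk k le_rfl) hR, fun ho => ?_⟩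
    rw [hb.owner_eq hR] at ho
    rw [v_succ, if_pos ho]
  by_cases hst : (∀ j, (Δ.succ (v j)).Nonempty) ∧ ∃ K, ∀ k ≥ K, ¬ main (v (k + 1))
  · right
    obtain ⟨hne, K, hK⟩ := hst
    refine ⟨hne, K, fun k hk => ⟨hK k hk, ?_, _, (inv k fun j _ => hne j).1⟩⟩
    have no : ∀ n k, K ≤ k → Γ.owner (u (moves main v k)) ≠ p →
        ¬ Δ.Reach main R n (v k) (u (moves main v k + 1)) := by
      intro n
      induction n using Nat.strong_induction_on with
      | _ n ih =>
        intro k hk ho hn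
        have := hfr _ _ _ hn
        have hv := v_succ k
        rw [if_neg ho] at hv
        rw [← hv] at this
        rcases this with h | ⟨-, i, hi, h⟩
        · exact hK k hk h.1
        · have e := moves_succ_of_not_main (hK k hk)
          rw [← e] at h ho
          exact ih i hi (k + 1) (by omega) ho h
    by_contra ho
    have hi := inv k fun j _ => hne j
    rw [hb.owner_eq hi.1] at ho
    obtain ⟨n, hn⟩ := hi.2.2.2 (hne k) ho
    exact no n k hk ho hn
  · left
    refine ⟨fun k hk => (inv k hk).1, fun h K => ?_⟩
    by_contra! h'
    exact hst ⟨h, K, h'⟩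

end GameGraph

/-! ### Plays and outcomes of interval parity games. -/

theorem length_history {S : Type*} (u : ℕ → S) (k : ℕ) : (history u k).length = k := by
  induction k with
  | zero => rfl
  | succ k ih => simp [history, ih]

namespace IntervalParityGame

variable {V V' : Type*} {M M' : ℕ}

/-- The graph of the states of a game. -/
def graph (G : IntervalParityGame V M) : GameGraph (GState V M) where
  owner s := G.owner s.1
  succ := G.succ

open scoped Classical in
/-- The outcome of a sequence of states. -/
noncomputable def playOutcome (G : IntervalParityGame V M) (u : ℕ → GState V M) : EReal :=
  if h : ∃ k, G.succ (u k) = ∅ then G.payoff (u (Nat.find h))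
  else if Even (G.limPrio u) then ⊤ else ⊥

theorem outcome_eq_playOutcome (G : IntervalParityGame V M) (σ : G.Strategy 0) (ρ : G.Strategy 1)
    (s : GState V M) : G.outcome σ ρ s = G.playOutcome fun k => (G.run σ ρ s k).2 :=
  rfl

theorem playOutcome_congr (G : IntervalParityGame V M) {u v : ℕ → GState V M}
    (h : ∀ k, (∀ j < k, (G.succ (u j)).Nonempty) → v k = u k) :
    G.playOutcome v = G.playOutcome u := by
  classical
  by_cases hu : ∃ k, G.succ (u k) = ∅
  · have h1 := Nat.find_spec hu
    have h2 : ∀ j < Nat.find hu, G.succ (u j) ≠ ∅ := fun j hj => Nat.find_min hu hj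
    have e : ∀ k ≤ Nat.find hu, v k = u k := fun k hk =>
      h k fun j hj => Set.nonempty_iff_ne_empty.2 (h2 j (by omega))
    have hv : ∃ k, G.succ (v k) = ∅ := ⟨Nat.find hu, by rw [e _ le_rfl, h1]⟩
    have ef : Nat.find hv = Nat.find hu := by
      refine (Nat.find_eq_iff hv).2 ⟨by rw [e _ le_rfl, h1], fun j hj => ?_⟩
      rw [e j hj.le]
      exact h2 j hj
    rw [playOutcome, playOutcome, dif_pos hu, dif_pos hv, ef, e _ le_rfl]
  · push Not at hu
    have : v = u := funext fun k => h k fun j _ => hu j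
    rw [this]

theorem run_fst (G : IntervalParityGame V M) (σ : G.Strategy 0) (ρ : G.Strategy 1)
    (s : GState V M) (k : ℕ) :
    (G.run σ ρ s k).1 = history (fun j => (G.run σ ρ s j).2) k := by
  induction k with
  | zero => rfl
  | succ k ih => rw [history, ← ih]; rfl

theorem run_succ_snd (G : IntervalParityGame V M) (σ : G.Strategy 0) (ρ : G.Strategy 1)
    (s : GState V M) (k : ℕ) :
    (G.owner (G.run σ ρ s k).2.1 = 0 → (G.run σ ρ s (k + 1)).2 =
      σ.1 (history (fun j => (G.run σ ρ s j).2) k) (G.run σ ρ s k).2) ∧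
    (G.owner (G.run σ ρ s k).2.1 = 1 → (G.run σ ρ s (k + 1)).2 =
      ρ.1 (history (fun j => (G.run σ ρ s j).2) k) (G.run σ ρ s k).2) := by
  rw [← run_fst]
  constructor <;> intro h <;> simp [run, h]

theorem run_succ_mem (G : IntervalParityGame V M) (σ : G.Strategy 0) (ρ : G.Strategy 1)
    (s : GState V M) (k : ℕ) (h : (G.succ (G.run σ ρ s k).2).Nonempty) :
    (G.run σ ρ s (k + 1)).2 ∈ G.succ (G.run σ ρ s k).2 := by
  obtain ⟨h0, h1⟩ := G.run_succ_snd σ ρ s k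
  by_cases ho : G.owner (G.run σ ρ s k).2.1 = 0
  · rw [h0 ho]
    exact σ.2 _ _ ho h
  · rw [h1 (by omega)]
    exact ρ.2 _ _ (by omega) h

theorem isPlay_run_zero (G : IntervalParityGame V M) (σ : G.Strategy 0) (ρ : G.Strategy 1)
    (s : GState V M) : G.graph.IsPlay 0 σ.1 s fun k => (G.run σ ρ s k).2 :=
  ⟨rfl, fun k hk => ⟨G.run_succ_mem σ ρ s k (hk k le_rfl), (G.run_succ_snd σ ρ s k).1⟩⟩

theorem isPlay_run_one (G : IntervalParityGame V M) (σ : G.Strategy 0) (ρ : G.Strategy 1)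
    (s : GState V M) : G.graph.IsPlay 1 ρ.1 s fun k => (G.run σ ρ s k).2 :=
  ⟨rfl, fun k hk => ⟨G.run_succ_mem σ ρ s k (hk k le_rfl), (G.run_succ_snd σ ρ s k).2⟩⟩

theorem outcome_eq_of_consistent (G : IntervalParityGame V M) (σ : G.Strategy 0)
    (ρ : G.Strategy 1) {s : GState V M} {u : ℕ → GState V M} (hu : u 0 = s)
    (h : ∀ k, (∀ j ≤ k, (G.succ (u j)).Nonempty) →
      (G.owner (u k).1 = 0 → u (k + 1) = σ.1 (history u k) (u k)) ∧
      (G.owner (u k).1 = 1 → u (k + 1) = ρ.1 (history u k) (u k))) :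
    G.outcome σ ρ s = G.playOutcome u := by
  have key : ∀ k, (∀ j < k, (G.succ (u j)).Nonempty) →
      G.run σ ρ s k = (history u k, u k) := by
    intro k
    induction k with
    | zero => intro _; rw [hu]; rfl
    | succ k ih =>
      intro hk
      obtain ⟨h0, h1⟩ := h k fun j hj => hk j (by omega)
      have e := ih fun j hj => hk j (by omega)
      rw [run]
      simp only [e]
      by_cases ho : G.owner (u k).1 = 0
      · rw [if_pos ho, history, h0 ho]
      · rw [if_neg ho, history, h1 (by omega)]
  rw [outcome_eq_playOutcome]
  exact G.playOutcome_congr fun k hk => by rw [key k hk]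

/-- The length of the history tells which term of `u` comes next. Hence any single play consistent
with a strategy arises against some strategy of the opponent, which is how plays enter the infima
and suprema over strategies. -/
theorem exists_strategy_following (G : IntervalParityGame V M) (p : Fin 2)
    {u : ℕ → GState V M} : ∃ τ : G.Strategy p, ∀ k, u (k + 1) ∈ G.succ (u k) →
      τ.1 (history u k) (u k) = u (k + 1) := by
  classical
  refine ⟨⟨fun h s => if u (h.length + 1) ∈ G.succ s then u (h.length + 1)
    else if hs : (G.succ s).Nonempty then hs.some else s, fun h s _ hs => ?_⟩, fun k hk => ?_⟩
  · dsimp only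
    split_ifs with h1
    · exact h1
    · exact hs.some_mem
  · simp [length_history, hk]

theorem exists_outcome_eq_zero (G : IntervalParityGame V M) (σ : G.Strategy 0)
    {s : GState V M} {u : ℕ → GState V M} (hu : G.graph.IsPlay 0 σ.1 s u) :
    ∃ ρ : G.Strategy 1, G.outcome σ ρ s = G.playOutcome u := by
  obtain ⟨ρ, hρ⟩ := G.exists_strategy_following 1 (u := u)
  exact ⟨ρ, G.outcome_eq_of_consistent σ ρ hu.zero fun k hk =>
    ⟨(hu.step k hk).2, fun _ => (hρ k (hu.step k hk).1).symm⟩⟩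

theorem exists_outcome_eq_one (G : IntervalParityGame V M) (ρ : G.Strategy 1)
    {s : GState V M} {u : ℕ → GState V M} (hu : G.graph.IsPlay 1 ρ.1 s u) :
    ∃ σ : G.Strategy 0, G.outcome σ ρ s = G.playOutcome u := by
  obtain ⟨σ, hσ⟩ := G.exists_strategy_following 0 (u := u)
  exact ⟨σ, G.outcome_eq_of_consistent σ ρ hu.zero fun k hk =>
    ⟨fun _ => (hσ k (hu.step k hk).1).symm, (hu.step k hk).2⟩⟩

theorem exists_frequently_prio (G : IntervalParityGame V M) (u : ℕ → GState V M) {P : ℕ → Prop}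
    (hP : ∃ᶠ k in atTop, P k) : ∃ c ≤ G.maxPrio, ∃ᶠ k in atTop, P k ∧ (G.prio (u k).1 : ℕ) = c := by
  by_contra! h
  have h' : ∀ c ∈ Finset.range (G.maxPrio + 1), ∀ᶠ k in atTop, P k → (G.prio (u k).1 : ℕ) ≠ c := by
    intro c hc
    have := h c (by simpa [Nat.lt_succ_iff] using hc)
    simpa [Filter.Frequently] using this
  have h2 := (Filter.eventually_all_finset _).2 h'
  obtain ⟨k, hk1, hk2⟩ := (hP.and_eventually h2).exists
  exact hk2 _ (by simpa using (G.prio (u k).1).2) hk1 rfl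

/-- There are finitely many priorities, so the infimum is over a nonempty set and is attained,
rather than being the default 0. -/
theorem frequently_limPrio (G : IntervalParityGame V M) (u : ℕ → GState V M) :
    ∃ᶠ k in atTop, (G.prio (u k).1 : ℕ) = G.limPrio u := by
  refine Nat.sInf_mem (s := {c | ∃ᶠ k in atTop, (G.prio (u k).1 : ℕ) = c}) ?_
  obtain ⟨c, -, hc⟩ := G.exists_frequently_prio u (P := fun _ => True)
    (Filter.Eventually.frequently (by simp))
  exact ⟨c, hc.mono fun _ h => h.2⟩

theorem limPrio_le (G : IntervalParityGame V M) {u : ℕ → GState V M} {c : ℕ}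
    (h : ∃ᶠ k in atTop, (G.prio (u k).1 : ℕ) = c) : G.limPrio u ≤ c :=
  Nat.sInf_le h

end IntervalParityGame

/-! ### Division by q in the extended reals. -/

section EReal

variable {a x : EReal} {q : ℕ} {ε : ℝ}

theorem le_div_add_iff (hq : 0 < q) :
    a ≤ x / (q : EReal) + (ε : EReal) ↔ (a - (ε : EReal)) * (q : EReal) ≤ x := by
  rw [← EReal.le_div_iff_mul_le (by exact_mod_cast hq) (EReal.natCast_ne_top q),
    EReal.sub_le_iff_le_add (Or.inl (EReal.coe_ne_bot ε)) (Or.inl (EReal.coe_ne_top ε))]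

theorem div_le_iff (hq : 0 < q) : x / (q : EReal) ≤ a ↔ x ≤ a * (q : EReal) :=
  (EReal.div_le_iff_le_mul (by exact_mod_cast hq) (EReal.natCast_ne_top q)).trans (by rw [mul_comm])

theorem div_le_add_iff_sub_le :
    x ≤ a + (ε : EReal) ↔ x - (ε : EReal) ≤ a :=
  (EReal.sub_le_iff_le_add (Or.inl (EReal.coe_ne_bot ε)) (Or.inl (EReal.coe_ne_top ε))).symm

theorem top_div_natCast (hq : 0 < q) : (⊤ : EReal) / (q : EReal) = ⊤ :=
  EReal.top_div_of_pos_ne_top (by exact_mod_cast hq) (EReal.natCast_ne_top q)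

theorem bot_div_natCast (hq : 0 < q) : (⊥ : EReal) / (q : EReal) = ⊥ :=
  EReal.bot_div_of_pos_ne_top (by exact_mod_cast hq) (EReal.natCast_ne_top q)

end EReal

/-! ### Simulations and the comparison of values. -/

namespace IntervalParityGame

variable {V V' : Type*} {M M' : ℕ}

/-- The relation `R` between the states of `G` and `G'` shows that `G'` simulates `G` up to a
stretching of the payoffs by `q` and an error of `ε`. Waiting in a state outside `main` forever
is losing for the owner of that state. -/
structure Simulation (G : IntervalParityGame V M) (G' : IntervalParityGame V' M')
    (main : GState V' M' → Prop) (R : GState V M → GState V' M' → Prop) (q : ℕ) (ε : ℝ) :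
    Prop where
  bisim : G.graph.StutterBisim G'.graph main R
  payoff : ∀ {s x}, R s x → G.succ s = ∅ → ExtClose (G.payoff s) (G'.payoff x / (q : EReal)) ε
  prio_main : ∀ {s x}, R s x → main x → (G'.prio x.1 : ℕ) = G.prio s.1
  prio_wait : ∀ {s x}, R s x → ¬ main x → G.maxPrio < G'.prio x.1
  even_prio_wait : ∀ {s x}, R s x → ¬ main x → (Even (G'.prio x.1 : ℕ) ↔ G'.owner x.1 = 1)

namespace Simulation

variable {G : IntervalParityGame V M} {G' : IntervalParityGame V' M'}
  {main : GState V' M' → Prop} {R : GState V M → GState V' M' → Prop} {q : ℕ} {ε : ℝ}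

/-- The limit priority occurs at some late waiting state, all of which belong to `r` and have the
parity that is losing for `r`. -/
theorem playOutcome_of_stuck (h : G.Simulation G' main R q ε) {r : Fin 2} {P : Fin 2 → Prop}
    (hP : ∀ o, P o → o = r) {v : ℕ → GState V' M'} (hv : G'.graph.Stuck main R P v) :
    G'.playOutcome v = if r = 1 then ⊤ else ⊥ := by
  obtain ⟨hne, K, hK⟩ := hv
  have h1 : ¬ ∃ k, G'.succ (v k) = ∅ := by
    rintro ⟨k, hk⟩
    exact (hne k).ne_empty hk
  rw [playOutcome, dif_neg h1]
  -- The offset 1 is needed because `hK` at `k - 1` is what places `v k` outside `main`.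
  have h2 := Filter.frequently_atTop.1 (G'.frequently_limPrio v) (K + 1)
  obtain ⟨k, hk, hk'⟩ := h2
  obtain ⟨-, ho, s, hs⟩ := hK k (by omega)
  have hm := (hK (k - 1) (by omega)).1
  rw [Nat.sub_add_cancel (by omega)] at hm
  have ho' : G'.owner (v k).1 = r := hP _ ho
  have := h.even_prio_wait hs hm
  rw [hk', ho'] at this
  simp only [this]

/-- States in `main` carry the priorities of `u`; waiting priorities exceed `G.maxPrio` and so
cannot be the lowest one. -/
theorem limPrio_of_match (h : G.Simulation G' main R q ε) {u : ℕ → GState V M}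
    {v : ℕ → GState V' M'} (hm : G'.graph.Match main R u v)
    (hne : ∀ k, (G'.succ (v k)).Nonempty) : G'.limPrio v = G.limPrio u := by
  have hrel : ∀ k, R (u (GameGraph.moves main v k)) (v k) := fun k => hm.rel k fun j _ => hne j
  have hfr := hm.frequently hne
  have to_u : ∀ c, (∃ᶠ k in atTop, main (v k) ∧ (G'.prio (v k).1 : ℕ) = c) →
      ∃ᶠ i in atTop, (G.prio (u i).1 : ℕ) = c := by
    intro c hc
    rw [Filter.frequently_atTop] at hc ⊢
    intro i
    obtain ⟨K, hK⟩ := GameGraph.exists_lt_moves hfr i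
    obtain ⟨k, hk, hmk, hck⟩ := hc K
    refine ⟨GameGraph.moves main v k, ?_, ?_⟩
    · have := GameGraph.moves_mono (main := main) (v := v) hk
      omega
    · rw [← h.prio_main (hrel k) hmk, hck]
  have to_v : ∀ c, (∃ᶠ i in atTop, (G.prio (u i).1 : ℕ) = c) →
      ∃ᶠ k in atTop, (G'.prio (v k).1 : ℕ) = c := by
    intro c hc
    rw [Filter.frequently_atTop] at hc ⊢
    intro K
    obtain ⟨i, hi, hci⟩ := hc (GameGraph.moves main v K + 1)
    obtain ⟨L, hL⟩ := GameGraph.exists_lt_moves hfr (i - 1)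
    obtain ⟨k, -, hk, hmk⟩ := GameGraph.exists_moves_eq hL
    refine ⟨k + 1, ?_, ?_⟩
    · by_contra! hlt
      have := GameGraph.moves_mono (main := main) (v := v) hlt.le
      rw [GameGraph.moves_succ_of_main hmk] at this
      omega
    · rw [h.prio_main (hrel _) hmk, GameGraph.moves_succ_of_main hmk, hk,
        Nat.sub_add_cancel (by omega), hci]
  have hle := G'.limPrio_le (to_v _ (G.frequently_limPrio u))
  have hbound : G.limPrio u ≤ G.maxPrio := by
    obtain ⟨k, hk⟩ := (G.frequently_limPrio u).exists
    rw [← hk]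
    exact Nat.lt_succ_iff.1 (G.prio (u k).1).2
  refine le_antisymm hle (G.limPrio_le (to_u _ ?_))
  refine (G'.frequently_limPrio v).mono fun k hk => ⟨?_, hk⟩
  by_contra hmk
  have := h.prio_wait (hrel k) hmk
  omega

theorem playOutcome_of_match (h : G.Simulation G' main R q ε) (hq : 0 < q)
    {u : ℕ → GState V M} {v : ℕ → GState V' M'} (hm : G'.graph.Match main R u v) :
    ExtClose (G.playOutcome u) (G'.playOutcome v / (q : EReal)) ε := by
  classical
  by_cases hv : ∃ k, G'.succ (v k) = ∅
  · have h1 := Nat.find_spec hv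
    have h2 : ∀ j < Nat.find hv, (G'.succ (v j)).Nonempty := fun j hj =>
      Set.nonempty_iff_ne_empty.2 (Nat.find_min hv hj)
    have hD := hm.rel _ h2
    have hdead : G.succ (u (GameGraph.moves main v (Nat.find hv))) = ∅ := by
      rw [← Set.not_nonempty_iff_eq_empty] at h1 ⊢
      exact fun h' => h1 ((h.bisim.nonempty_iff hD).2 h')
    have hu : ∃ k, G.succ (u k) = ∅ := ⟨_, hdead⟩
    have e : Nat.find hu = GameGraph.moves main v (Nat.find hv) := by
      refine (Nat.find_eq_iff hu).2 ⟨hdead, fun i hi => ?_⟩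
      obtain ⟨k, hk, rfl, -⟩ := GameGraph.exists_moves_eq hi
      exact (((h.bisim.nonempty_iff (hm.rel k fun j hj => h2 j (hj.trans hk))).1 (h2 k hk))).ne_empty
    rw [playOutcome, playOutcome, dif_pos hu, dif_pos hv, e]
    exact h.payoff hD hdead
  · push Not at hv
    have hu : ¬ ∃ k, G.succ (u k) = ∅ := by
      rintro ⟨i, hi⟩
      obtain ⟨K, hK⟩ := GameGraph.exists_lt_moves (hm.frequently hv) i
      obtain ⟨k, -, rfl, -⟩ := GameGraph.exists_moves_eq hK
      exact ((h.bisim.nonempty_iff (hm.rel k fun j _ => hv j)).1 (hv k)).ne_empty hi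
    have hv' : ¬ ∃ k, G'.succ (v k) = ∅ := by
      rintro ⟨k, hk⟩
      exact (hv k).ne_empty hk
    rw [playOutcome, playOutcome, dif_neg hu, dif_neg hv', h.limPrio_of_match hm hv]
    split_ifs
    · rw [top_div_natCast hq]
      simp [ExtClose]
    · rw [bot_div_natCast hq]
      simp [ExtClose]

theorem exists_right_strategy (h : G.Simulation G' main R q ε) {p : Fin 2} (σ : G.Strategy p)
    {s : GState V M} {x : GState V' M'} (hs : R s x) (hx : main x) :
    ∃ τ : G'.Strategy p, ∀ v, G'.graph.IsPlay p τ.1 x v →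
      (∃ u, G.graph.IsPlay p σ.1 s u ∧ G'.graph.Match main R u v) ∨
        G'.graph.Stuck main R (· ≠ p) v :=
  let ⟨τ, hτ, hv⟩ := h.bisim.exists_right_strategy σ.2 hs hx
  ⟨⟨τ, hτ⟩, hv⟩

theorem exists_left_strategy (h : G.Simulation G' main R q ε) {p : Fin 2} (τ : G'.Strategy p)
    {s : GState V M} {x : GState V' M'} (hs : R s x) (hx : main x) :
    ∃ σ : G.Strategy p, ∀ u, G.graph.IsPlay p σ.1 s u →
      ∃ v, G'.graph.IsPlay p τ.1 x v ∧
        (G'.graph.Match main R u v ∨ G'.graph.Stuck main R (· = p) v) :=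
  let ⟨σ, hσ, hu⟩ := h.bisim.exists_left_strategy τ.2 hs hx
  ⟨⟨σ, hσ⟩, hu⟩

/-- For each inequality a strategy of Player 0 is transferred. If the simulation gets stuck, the
player to blame makes the inequality trivial: the opponent gives `⊤` in the first half, and Player 0
gives `⊥` in the second. -/
theorem extClose_lowerVal (h : G.Simulation G' main R q ε) (hq : 0 < q) {s : GState V M}
    {x : GState V' M'} (hs : R s x) (hx : main x) :
    ExtClose (G.lowerVal s) (G'.lowerVal x / (q : EReal)) ε := by
  constructor
  · refine iSup_le fun σ => ?_
    rw [le_div_add_iff hq]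
    obtain ⟨τ, hplay⟩ := h.exists_right_strategy σ hs hx
    refine le_iSup_of_le τ (le_iInf fun ρ' => ?_)
    rw [← le_div_add_iff hq, outcome_eq_playOutcome]
    rcases hplay _ (G'.isPlay_run_zero τ ρ' x) with ⟨u, hu, hm⟩ | hst
    · obtain ⟨ρ, hρ⟩ := G.exists_outcome_eq_zero σ hu
      refine (iInf_le _ ρ).trans ?_
      rw [hρ]
      exact (h.playOutcome_of_match hq hm).1
    · rw [h.playOutcome_of_stuck (r := 1) (fun o ho => by omega) hst, if_pos rfl,
        top_div_natCast hq]
      simp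
  · rw [div_le_iff hq]
    refine iSup_le fun τ => ?_
    rw [← div_le_iff hq, div_le_add_iff_sub_le]
    obtain ⟨σ, hplay⟩ := h.exists_left_strategy τ hs hx
    refine le_iSup_of_le σ (le_iInf fun ρ => ?_)
    rw [← div_le_add_iff_sub_le, outcome_eq_playOutcome]
    obtain ⟨v, hv, hm⟩ := hplay _ (G.isPlay_run_zero σ ρ s)
    obtain ⟨ρ', hρ'⟩ := G'.exists_outcome_eq_zero τ hv
    refine (EReal.div_le_div_right_of_nonneg (by positivity) (iInf_le _ ρ')).trans ?_
    rw [hρ']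
    rcases hm with hm | hst
    · exact (h.playOutcome_of_match hq hm).2
    · rw [h.playOutcome_of_stuck (r := 0) (fun o ho => ho) hst, if_neg (by decide),
        bot_div_natCast hq]
      exact bot_le

theorem extClose_upperVal (h : G.Simulation G' main R q ε) (hq : 0 < q) {s : GState V M}
    {x : GState V' M'} (hs : R s x) (hx : main x) :
    ExtClose (G.upperVal s) (G'.upperVal x / (q : EReal)) ε := by
  constructor
  · rw [le_div_add_iff hq]
    refine le_iInf fun τ => ?_
    rw [← le_div_add_iff hq]
    obtain ⟨ρ, hplay⟩ := h.exists_left_strategy τ hs hx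
    refine iInf_le_of_le ρ (iSup_le fun σ => ?_)
    rw [outcome_eq_playOutcome]
    obtain ⟨v, hv, hm⟩ := hplay _ (G.isPlay_run_one σ ρ s)
    obtain ⟨σ', hσ'⟩ := G'.exists_outcome_eq_one τ hv
    refine le_trans ?_ (add_le_add_left (EReal.div_le_div_right_of_nonneg (by positivity)
      (le_iSup _ σ')) _)
    rw [hσ']
    rcases hm with hm | hst
    · exact (h.playOutcome_of_match hq hm).1
    · rw [h.playOutcome_of_stuck (r := 1) (fun o ho => ho) hst, if_pos rfl,
        top_div_natCast hq]
      simp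
  · rw [div_le_add_iff_sub_le]
    refine le_iInf fun ρ => ?_
    rw [← div_le_add_iff_sub_le, div_le_iff hq]
    obtain ⟨τ, hplay⟩ := h.exists_right_strategy ρ hs hx
    refine iInf_le_of_le τ (iSup_le fun σ' => ?_)
    rw [← div_le_iff hq, outcome_eq_playOutcome]
    rcases hplay _ (G'.isPlay_run_one σ' τ x) with ⟨u, hu, hm⟩ | hst
    · obtain ⟨σ, hσ⟩ := G.exists_outcome_eq_one ρ hu
      refine le_trans ?_ (add_le_add_left (le_iSup (fun σ => G.outcome σ ρ s) σ) _)
      rw [hσ]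
      exact (h.playOutcome_of_match hq hm).2
    · rw [h.playOutcome_of_stuck (r := 0) (fun o ho => by omega) hst, if_neg (by decide),
        bot_div_natCast hq]
      exact bot_le

end Simulation

end IntervalParityGame

/-! ### Clock configurations and delays. -/

/-- Clock readings at some instant. The reading of the clock `i` is infinite or the sum of `floor i`
and the difference between `now`, the fractional part of the current time, and `stamp i`, the
fractional part of the time of the last reset. -/
structure ClockConfig (M : ℕ) where
  floor : Fin M → ℤ
  infinite : Fin M → Prop
  now : ℝ
  stamp : Fin M → ℝ

/-- The passing of some time: the number of integers passed by the current time, the fractional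
part of the new current time, and whether the delay is infinite instead. -/
structure Delay where
  ticks : ℕ
  now : ℝ
  infinite : Prop

/-- The finite information about clock readings that determines which moves are possible: which
readings are infinite, the other ones rounded and clamped to `[L, C]`, and the order of `0`, the
fractional part of the current time and the fractional parts of the reset times. -/
abbrev ClockInfo (M : ℕ) (L C : ℤ) : Type :=
  (Fin M → Prop) × (Fin M → Set.Icc L C) ×
    (Option (Option (Fin M)) → Option (Option (Fin M)) → Prop)

/-- The new fractional part lies in `[0, 1)`. -/
def Delay.Valid (d : Delay) : Prop := 0 ≤ d.now ∧ d.now < 1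

namespace ClockConfig

variable {M : ℕ} {L C : ℤ}

/-- All fractional parts lie in `[0, 1)`, and `L` is a lower bound of the rounded readings. -/
structure Valid (c : ClockConfig M) (L : ℤ) : Prop where
  floor_ge : ∀ i, L ≤ c.floor i
  now_mem : 0 ≤ c.now ∧ c.now < 1
  stamp_mem : ∀ i, 0 ≤ c.stamp i ∧ c.stamp i < 1

/-- The points in `[0, 1)` whose order matters. -/
def points (c : ClockConfig M) : Option (Option (Fin M)) → ℝ
  | none => 0
  | some none => c.now
  | some (some i) => c.stamp i

/-- The finite information about a configuration. -/
noncomputable def info (c : ClockConfig M) (h : L ≤ C) : ClockInfo M L C :=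
  (c.infinite, fun i => Set.projIcc L C h (c.floor i), fun a b => c.points a ≤ c.points b)

open scoped Classical in
/-- The clock readings, in units of `q` ticks. -/
noncomputable def value (c : ClockConfig M) (q : ℕ) (i : Fin M) : EReal :=
  if c.infinite i then ⊤ else (((c.floor i + (c.now - c.stamp i)) / q : ℝ) : EReal)

open scoped Classical in
/-- The duration of a delay, in units of `q` ticks. -/
noncomputable def duration (c : ClockConfig M) (q : ℕ) (d : Delay) : EReal :=
  if d.infinite then ⊤ else ((((d.ticks : ℤ) + (d.now - c.now)) / q : ℝ) : EReal)

/-- The configuration after a delay and the reset of the clocks in `R`. -/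
def next (c : ClockConfig M) (d : Delay) (R : Finset (Fin M)) : ClockConfig M where
  floor i := if i ∈ R then 0 else c.floor i + d.ticks
  infinite i := i ∉ R ∧ (c.infinite i ∨ d.infinite)
  now := d.now
  stamp i := if i ∈ R then d.now else c.stamp i

theorem points_mem {c : ClockConfig M} (hc : c.Valid L) (a : Option (Option (Fin M))) :
    0 ≤ c.points a ∧ c.points a < 1 := by
  rcases a with _ | _ | i
  · simp [points]
  · exact hc.now_mem
  · exact hc.stamp_mem i

theorem Valid.next {c : ClockConfig M} (hc : c.Valid L) (hL : L ≤ 0) {d : Delay} (hd : d.Valid)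
    (R : Finset (Fin M)) : (c.next d R).Valid L where
  floor_ge i := by
    have := hc.floor_ge i
    simp only [ClockConfig.next]
    split_ifs <;> omega
  now_mem := hd
  stamp_mem i := by
    simp only [ClockConfig.next]
    split_ifs
    · exact hd
    · exact hc.stamp_mem i

theorem value_of_infinite {c : ClockConfig M} {i : Fin M} (h : c.infinite i) (q : ℕ) :
    c.value q i = ⊤ :=
  if_pos h

theorem value_of_not_infinite {c : ClockConfig M} {i : Fin M} (h : ¬ c.infinite i) (q : ℕ) :
    c.value q i = (((c.floor i + (c.now - c.stamp i)) / q : ℝ) : EReal) :=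
  if_neg h

theorem duration_of_infinite (c : ClockConfig M) (q : ℕ) {d : Delay} (h : d.infinite) :
    c.duration q d = ⊤ :=
  if_pos h

theorem duration_of_not_infinite (c : ClockConfig M) (q : ℕ) {d : Delay} (h : ¬ d.infinite) :
    c.duration q d = ((((d.ticks : ℤ) + (d.now - c.now)) / q : ℝ) : EReal) :=
  if_neg h

theorem value_next_of_mem (c : ClockConfig M) (q : ℕ) (d : Delay) {R : Finset (Fin M)} {i : Fin M}
    (hi : i ∈ R) : (c.next d R).value q i = 0 := by
  rw [value_of_not_infinite (c := c.next d R) fun h => h.1 hi]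
  simp [next, hi]

theorem value_next_of_notMem (c : ClockConfig M) (q : ℕ) (d : Delay) {R : Finset (Fin M)}
    {i : Fin M} (hi : i ∉ R) : (c.next d R).value q i = c.value q i + c.duration q d := by
  by_cases h1 : c.infinite i
  · rw [value_of_infinite (c := c.next d R) ⟨hi, Or.inl h1⟩, value_of_infinite h1]
    by_cases h2 : d.infinite
    · rw [duration_of_infinite c q h2]
      rfl
    · rw [duration_of_not_infinite c q h2, EReal.top_add_coe]
  · rw [value_of_not_infinite h1]
    by_cases h2 : d.infinite
    · rw [duration_of_infinite c q h2, value_of_infinite (c := c.next d R) ⟨hi, Or.inr h2⟩, EReal.coe_add_top]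
    · rw [duration_of_not_infinite c q h2, value_of_not_infinite (c := c.next d R) fun h =>
          h.2.elim h1 h2,
        ← EReal.coe_add]
      congr 1
      simp only [next, if_neg hi]
      push_cast
      ring

/-- A finite `t` is realised by the integer and fractional parts of `c.now + q * t`. -/
theorem exists_duration_eq {c : ClockConfig M} (hc : c.Valid L) {q : ℕ} (hq : 0 < q) {t : EReal}
    (ht : 0 ≤ t) : ∃ d : Delay, d.Valid ∧ c.duration q d = t := by
  induction t with
  | bot => simp at ht
  | top => exact ⟨⟨0, c.now, True⟩, hc.now_mem, by simp [duration]⟩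
  | coe t =>
    have ht' : 0 ≤ t := by exact_mod_cast ht
    have hx : 0 ≤ c.now + q * t := add_nonneg hc.now_mem.1 (by positivity)
    refine ⟨⟨⌊c.now + q * t⌋₊, Int.fract (c.now + q * t), False⟩,
      ⟨Int.fract_nonneg _, Int.fract_lt_one _⟩, ?_⟩
    have hq' : (q : ℝ) ≠ 0 := by positivity
    simp only [duration, if_false]
    congr 1
    rw [Int.natCast_floor_eq_floor hx, div_eq_iff hq']
    have := Int.floor_add_fract (c.now + q * t)
    linarith

end ClockConfig

/-! ### Integer thresholds and the invariance of regions. -/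

theorem intCast_add_le_iff {Z E : ℤ} {a : ℝ} (h : |a| < 1) :
    (Z : ℝ) + a ≤ E ↔ Z < E ∨ (Z = E ∧ a ≤ 0) := by
  obtain ⟨h1, h2⟩ := abs_lt.1 h
  rcases lt_trichotomy Z E with hZ | rfl | hZ
  · have : (Z : ℝ) + 1 ≤ E := by exact_mod_cast hZ
    simp only [hZ, true_or, iff_true]
    linarith
  · simp
  · have h3 : (E : ℝ) + 1 ≤ Z := by exact_mod_cast hZ
    simp only [hZ.not_gt, hZ.ne', false_and, or_self, iff_false]
    linarith

theorem le_intCast_add_iff {Z E : ℤ} {a : ℝ} (h : |a| < 1) :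
    (E : ℝ) ≤ (Z : ℝ) + a ↔ E < Z ∨ (Z = E ∧ 0 ≤ a) := by
  have := intCast_add_le_iff (Z := -Z) (E := -E) (a := -a) (by rwa [abs_neg])
  push_cast at this
  rw [show (E : ℝ) ≤ Z + a ↔ -(Z : ℝ) + -a ≤ -E by constructor <;> intro <;> linarith, this]
  simp

theorem ExtInterval.mem_toSet_iff_of_forall_int {I : ExtInterval} (hI : I.IsOverInt) {B : ℤ}
    (hlo : ∀ k : ℤ, I.lo = ((k : ℝ) : EReal) → k ≤ B)
    (hhi : ∀ k : ℤ, I.hi = ((k : ℝ) : EReal) → k ≤ B) {x y : ℝ}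
    (h : ∀ k : ℤ, k ≤ B → ((x ≤ k ↔ y ≤ k) ∧ ((k : ℝ) ≤ x ↔ (k : ℝ) ≤ y))) :
    (x : EReal) ∈ I.toSet ↔ (y : EReal) ∈ I.toSet := by
  have key : ∀ z : EReal, IsExtInt z → (∀ k : ℤ, z = ((k : ℝ) : EReal) → k ≤ B) →
      (((x : EReal) ≤ z ↔ (y : EReal) ≤ z) ∧ (z ≤ (x : EReal) ↔ z ≤ (y : EReal))) := by
    rintro z (rfl | rfl | ⟨k, rfl⟩) hz
    · simp
    · simp
    · simpa only [EReal.coe_le_coe_iff] using h k (hz k rfl)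
  obtain ⟨h1, h2⟩ := key _ hI.1 hlo
  obtain ⟨h3, h4⟩ := key _ hI.2 hhi
  have h5 : (x : EReal) = I.lo ↔ (y : EReal) = I.lo := by
    rw [le_antisymm_iff, le_antisymm_iff, h1, h2]
  have h6 : (x : EReal) = I.hi ↔ (y : EReal) = I.hi := by
    rw [le_antisymm_iff, le_antisymm_iff, h3, h4]
  simp only [ExtInterval.toSet, Set.mem_ofPred_eq, h2, h3, h5, h6]

/-- Every finite endpoint becomes an integer below `D` after scaling by `q`; comparing `Z + a` with
it needs only `Z`, up to identifying all values from `D` on, and the sign of `a`. -/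
theorem ExtInterval.mem_toSet_iff_of_rounding {I : ExtInterval} (hI : I.IsOverInt) {B D : ℤ}
    {q : ℕ} (hq : 0 < q) (hlo : ∀ k : ℤ, I.lo = ((k : ℝ) : EReal) → k ≤ B)
    (hhi : ∀ k : ℤ, I.hi = ((k : ℝ) : EReal) → k ≤ B) (hD : q * B < D) {Z Z' : ℤ} {a a' : ℝ}
    (ha : |a| < 1) (ha' : |a'| < 1) (h1 : a ≤ 0 ↔ a' ≤ 0) (h2 : 0 ≤ a ↔ 0 ≤ a')
    (hZ : Z = Z' ∨ (D ≤ Z ∧ D ≤ Z')) :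
    ((((Z : ℝ) + a) / q : ℝ) : EReal) ∈ I.toSet ↔
      ((((Z' : ℝ) + a') / q : ℝ) : EReal) ∈ I.toSet := by
  refine I.mem_toSet_iff_of_forall_int hI hlo hhi fun k hk => ?_
  have hq' : (0 : ℝ) < q := by exact_mod_cast hq
  have hlt : (q : ℤ) * k < D :=
    (mul_le_mul_of_nonneg_left hk (by positivity)).trans_lt hD
  have e : (k : ℝ) * q = ((q * k : ℤ) : ℝ) := by push_cast; ring
  rw [div_le_iff₀ hq', div_le_iff₀ hq', le_div_iff₀ hq', le_div_iff₀ hq', e,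
    intCast_add_le_iff ha, intCast_add_le_iff ha', le_intCast_add_iff ha, le_intCast_add_iff ha',
    h1, h2]
  rcases hZ with rfl | ⟨h3, h4⟩
  · exact ⟨Iff.rfl, Iff.rfl⟩
  · constructor
    · constructor <;> rintro (h | h) <;> omega
    · constructor <;> intro <;> left <;> omega

theorem eq_or_le_of_projIcc_eq {L C : ℤ} (h : L ≤ C) {x y : ℤ} (hx : L ≤ x) (hy : L ≤ y)
    (e : Set.projIcc L C h x = Set.projIcc L C h y) : x = y ∨ (C ≤ x ∧ C ≤ y) := by
  have := congrArg Subtype.val e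
  rw [Set.coe_projIcc, Set.coe_projIcc] at this
  omega

/-- If `t` coincides with a point, its counterpart is taken; otherwise density of the reals provides
a value in the corresponding gap. -/
theorem exists_order_extension {P : Type*} [Finite P] {p p' : P → ℝ} {o : P}
    (h : ∀ a b, p a ≤ p b ↔ p' a ≤ p' b) {t : ℝ} (ho : p o ≤ t) (h1 : ∀ a, p' a < 1) :
    ∃ t', t' < 1 ∧ ∀ a, (p a ≤ t ↔ p' a ≤ t') ∧ (t ≤ p a ↔ t' ≤ p' a) := by
  classical
  cases nonempty_fintype P
  by_cases heq : ∃ a, p a = t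
  · obtain ⟨a, rfl⟩ := heq
    exact ⟨p' a, h1 a, fun b => ⟨h b a, h a b⟩⟩
  · obtain ⟨t', h2, h3⟩ := Order.exists_between_finsets
      ((Finset.univ.filter fun a => p a ≤ t).image p')
      -- Inserting 1 among the upper points keeps `t'` a fractional part.
      (insert 1 ((Finset.univ.filter fun a => t ≤ p a).image p')) (by
        simp only [Finset.mem_image, Finset.mem_filter, Finset.mem_univ, true_and,
          Finset.mem_insert]
        rintro _ ⟨a, ha, rfl⟩ _ (rfl | ⟨b, hb, rfl⟩)
        · exact h1 a
        · rw [← not_le, ← h, not_le]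
          refine lt_of_le_of_ne (ha.trans hb) fun e => heq ⟨a, le_antisymm ha (e ▸ hb)⟩)
    have h2' : ∀ a, p a ≤ t → p' a < t' := fun a ha => h2 _ (by
      simp only [Finset.mem_image, Finset.mem_filter, Finset.mem_univ, true_and]
      exact ⟨a, ha, rfl⟩)
    have h3' : ∀ a, t ≤ p a → t' < p' a := fun a ha => h3 _ (by
      simp only [Finset.mem_image, Finset.mem_filter, Finset.mem_univ, true_and,
        Finset.mem_insert]
      exact Or.inr ⟨a, ha, rfl⟩)
    refine ⟨t', h3 _ (Finset.mem_insert_self _ _), fun a => ⟨⟨fun ha => (h2' a ha).le, ?_⟩,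
      ⟨fun ha => (h3' a ha).le, ?_⟩⟩⟩
    · intro ha
      by_contra! hlt
      exact absurd (h3' a hlt.le) ha.not_gt
    · intro ha
      by_contra! hlt
      exact absurd (h2' a hlt.le) ha.not_gt

namespace ClockConfig

variable {M : ℕ} {L C : ℤ} {h : L ≤ C} {c c' : ClockConfig M}

theorem infinite_eq_of_info_eq (e : c.info h = c'.info h) : c.infinite = c'.infinite :=
  congrArg Prod.fst e

theorem projIcc_eq_of_info_eq (e : c.info h = c'.info h) (i : Fin M) :
    Set.projIcc L C h (c.floor i) = Set.projIcc L C h (c'.floor i) :=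
  congrFun (congrArg (fun x => x.2.1) e) i

theorem points_le_iff_of_info_eq (e : c.info h = c'.info h) (a b : Option (Option (Fin M))) :
    c.points a ≤ c.points b ↔ c'.points a ≤ c'.points b :=
  iff_of_eq (congrFun (congrFun (congrArg (fun x => x.2.2) e) a) b)

theorem floor_of_info_eq (hc : c.Valid L) (hc' : c'.Valid L) (e : c.info h = c'.info h)
    (i : Fin M) : c.floor i = c'.floor i ∨ (C ≤ c.floor i ∧ C ≤ c'.floor i) :=
  eq_or_le_of_projIcc_eq h (hc.floor_ge i) (hc'.floor_ge i) (projIcc_eq_of_info_eq e i)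

theorem value_mem_iff (hc : c.Valid L) (hc' : c'.Valid L) (e : c.info h = c'.info h)
    {I : ExtInterval} (hI : I.IsOverInt) {B : ℤ} {q : ℕ} (hq : 0 < q)
    (hlo : ∀ k : ℤ, I.lo = ((k : ℝ) : EReal) → k ≤ B)
    (hhi : ∀ k : ℤ, I.hi = ((k : ℝ) : EReal) → k ≤ B) (hC : q * B < C) (i : Fin M) :
    c.value q i ∈ I.toSet ↔ c'.value q i ∈ I.toSet := by
  have hinf := congrFun (infinite_eq_of_info_eq e) i
  by_cases hi : c.infinite i
  · rw [value_of_infinite hi, value_of_infinite (hinf ▸ hi)]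
  · rw [value_of_not_infinite hi, value_of_not_infinite (hinf ▸ hi)]
    have h1 := hc.now_mem
    have h2 := hc.stamp_mem i
    have h3 := hc'.now_mem
    have h4 := hc'.stamp_mem i
    refine I.mem_toSet_iff_of_rounding hI hq hlo hhi hC ?_ ?_ ?_ ?_ (floor_of_info_eq hc hc' e i)
    · rw [abs_lt]
      constructor <;> linarith
    · rw [abs_lt]
      constructor <;> linarith
    · rw [sub_nonpos, sub_nonpos]
      exact points_le_iff_of_info_eq e (some none) (some (some i))
    · rw [sub_nonneg, sub_nonneg]
      exact points_le_iff_of_info_eq e (some (some i)) (some none)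

/-- Which of the points after a reset are old ones, the other ones being the new current time. -/
def oldPoint (R : Finset (Fin M)) : Option (Option (Fin M)) → Option (Option (Option (Fin M)))
  | none => some none
  | some none => none
  | some (some i) => if i ∈ R then none else some (some (some i))

theorem points_next (c : ClockConfig M) (d : Delay) (R : Finset (Fin M))
    (a : Option (Option (Fin M))) :
    (c.next d R).points a = (oldPoint R a).elim d.now c.points := by
  rcases a with _ | _ | i
  · rfl
  · rfl
  · by_cases hi : i ∈ R <;> simp [points, next, oldPoint, hi]

/-- The heart of the region argument. The new fractional part is placed among the points of `c'` as
`d.now` lies among those of `c`, and the tick counts agree or both reach `J`, where neither clamped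
floors nor time intervals notice a difference. -/
theorem exists_delay (hc : c.Valid L) (hc' : c'.Valid L) (e : c.info h = c'.info h)
    {d : Delay} (hd : d.Valid) {J k : ℕ} (hJ : C - L ≤ J) (hk : min d.ticks J = min k J) :
    ∃ d' : Delay, d'.Valid ∧ d'.ticks = k ∧
      (∀ R, (c.next d R).info h = (c'.next d' R).info h) ∧
      ∀ (I : ExtInterval), I.IsOverInt → ∀ (B : ℤ) (q : ℕ), 0 < q →
        (∀ k : ℤ, I.lo = ((k : ℝ) : EReal) → k ≤ B) →
        (∀ k : ℤ, I.hi = ((k : ℝ) : EReal) → k ≤ B) → q * B < J →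
        (c.duration q d ∈ I.toSet ↔ c'.duration q d' ∈ I.toSet) := by
  obtain ⟨t, ht1, ht⟩ := exists_order_extension (points_le_iff_of_info_eq e) (o := none) hd.1
    fun a => (points_mem hc' a).2
  have ht0 : 0 ≤ t := (ht none).1.1 hd.1
  refine ⟨⟨k, t, d.infinite⟩, ⟨ht0, ht1⟩, rfl, fun R => ?_, fun I hI B q hq hlo hhi hB => ?_⟩
  · refine Prod.ext ?_ (Prod.ext ?_ ?_)
    · simp only [info, next, infinite_eq_of_info_eq e]
    · funext i
      apply Subtype.ext
      simp only [info, next, Set.coe_projIcc]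
      split_ifs with hi
      · rfl
      -- From `J` ticks on, `C - L ≤ J` lifts every floor to at least `C`, where clamping identifies
      -- all values.
      · have h1 := hc.floor_ge i
        have h2 := hc'.floor_ge i
        have h3 := floor_of_info_eq hc hc' e i
        omega
    · funext a b
      have key : ∀ x y : Option (Option (Option (Fin M))),
          x.elim d.now c.points ≤ y.elim d.now c.points ↔
            x.elim t c'.points ≤ y.elim t c'.points := by
        rintro (_ | x) (_ | y)
        · simp
        · exact (ht y).2
        · exact (ht x).1
        · exact points_le_iff_of_info_eq e x y
      simp only [info, points_next]
      exact propext (key _ _)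
  · simp only [duration]
    split_ifs with hi
    · rfl
    · have h1 := hc.now_mem
      have h3 := hc'.now_mem
      have h5 := hd.1
      have h6 := hd.2
      refine I.mem_toSet_iff_of_rounding hI hq hlo hhi hB ?_ ?_ ?_ ?_ ?_
      · rw [abs_lt]
        constructor <;> linarith
      · rw [abs_lt]
        constructor <;> linarith
      · rw [sub_nonpos, sub_nonpos]
        exact (ht (some none)).2
      · rw [sub_nonneg, sub_nonneg]
        exact (ht (some none)).1
      · omega

end ClockConfig

/-! ### The counter-reset game of ticks. -/

theorem IsExtInt.natCast_mul {x : EReal} (h : IsExtInt x) {q : ℕ} (hq : 0 < q) :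
    IsExtInt ((q : EReal) * x) := by
  have hq' : (0 : ℝ) < q := by exact_mod_cast hq
  rcases h with rfl | rfl | ⟨k, rfl⟩
  · exact Or.inl (EReal.coe_mul_bot_of_pos hq')
  · exact Or.inr (Or.inl (EReal.coe_mul_top_of_pos hq'))
  · refine Or.inr (Or.inr ⟨q * k, ?_⟩)
    push_cast
    exact (EReal.coe_mul _ _).symm

theorem IsExtInt.add {x y : EReal} (hx : IsExtInt x) (hy : IsExtInt y) : IsExtInt (x + y) := by
  rcases hx with rfl | rfl | ⟨k, rfl⟩
  · exact Or.inl (EReal.bot_add y)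
  · rcases hy with rfl | rfl | ⟨l, rfl⟩
    · exact Or.inl (EReal.add_bot _)
    · exact Or.inr (Or.inl rfl)
    · exact Or.inr (Or.inl (EReal.top_add_coe _))
  · rcases hy with rfl | rfl | ⟨l, rfl⟩
    · exact Or.inl (EReal.add_bot _)
    · exact Or.inr (Or.inl (EReal.coe_add_top _))
    · refine Or.inr (Or.inr ⟨k + l, ?_⟩)
      push_cast
      exact (EReal.coe_add _ _).symm

theorem IsExtInt.zero : IsExtInt 0 := Or.inr (Or.inr ⟨0, by simp⟩)

theorem IsExtInt.mul_top (x : EReal) : IsExtInt (x * ⊤) := by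
  rcases lt_trichotomy x 0 with h | rfl | h
  · exact Or.inl (EReal.mul_top_of_neg h)
  · rw [zero_mul]
    exact IsExtInt.zero
  · exact Or.inr (Or.inl (EReal.mul_top_of_pos h))

namespace IntervalParityGame

variable {V W : Type*} {M : ℕ} {L C : ℤ}

/-- After the delay `d` in a state with position `v` and clock readings `c`, the transition `l`
to the position `w` is possible. -/
def Enabled (G : IntervalParityGame V M) (q : ℕ) (v w : V) (c : ClockConfig M) (d : Delay)
    (l : TransLabel M) : Prop :=
  G.edge v w ∧ l ∈ G.label v w ∧ (∀ i, c.value q i ∈ (l.constr i).toSet) ∧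
    c.duration q d ∈ l.time.toSet

/-- A valid delay may have negative duration (no ticks, smaller fractional part), but membership in
the time interval excludes this. Conversely, all admissible times are nonnegative and hence come
from a delay. -/
theorem succ_value (G : IntervalParityGame V M) (hflat : G.IsFlat) {q : ℕ} (hq : 0 < q)
    {c : ClockConfig M} (hc : c.Valid L) (v : V) (s : GState V M) :
    s ∈ G.succ (v, c.value q) ↔ ∃ (d : Delay) (l : TransLabel M), d.Valid ∧
      G.Enabled q v s.1 c d l ∧ s.2 = (c.next d l.reset).value q := by
  constructor
  · rintro ⟨l, h1, h2, h3, h4, t, ht, h5⟩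
    obtain ⟨d, hd, rfl⟩ := c.exists_duration_eq hc hq (l.time_lo_nonneg.trans ht.1)
    refine ⟨d, l, hd, ⟨h1, h2, h3, ht⟩, funext fun i => ?_⟩
    by_cases hi : i ∈ l.reset
    · rw [h4 i hi, c.value_next_of_mem q d hi]
    · rw [h5 i hi, c.value_next_of_notMem q d hi, hflat, EReal.coe_one, one_mul]
  · rintro ⟨d, l, hd, ⟨h1, h2, h3, h4⟩, h5⟩
    refine ⟨l, h1, h2, h3, fun i hi => ?_, _, h4, fun i hi => ?_⟩
    · rw [h5, c.value_next_of_mem q d hi]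
    · rw [h5, c.value_next_of_notMem q d hi, hflat, EReal.coe_one, one_mul]

/-- A position of the original game, finite information about the clock readings at the beginning
of the move, and the number of ticks passed since then, up to `J`. -/
abbrev TickPosition (W : Type*) (M : ℕ) (L C : ℤ) (J : ℕ) :=
  W × ClockInfo M L C × Fin (J + 1)

/-- The move may end in the position `w` and the clock information `j`, after the reset of `R`. -/
def Finish (G : IntervalParityGame V M) (e : W ≃ V) (q : ℕ) (hLC : L ≤ C) {J : ℕ}
    (x : TickPosition W M L C J) (R : Finset (Fin M)) (w : W) (j : ClockInfo M L C) : Prop :=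
  ∃ (c : ClockConfig M) (d : Delay) (l : TransLabel M), c.Valid L ∧ d.Valid ∧
    c.info hLC = x.2.1 ∧ min d.ticks J = (x.2.2 : ℕ) ∧ G.Enabled q (e x.1) (e w) c d l ∧
    l.reset = R ∧ (c.next d R).info hLC = j

/-- The move may end after some number of ticks. -/
def CanMove (G : IntervalParityGame V M) (e : W ≃ V) (q : ℕ) (hLC : L ≤ C) (J : ℕ) (v : W)
    (i : ClockInfo M L C) : Prop :=
  ∃ (k : Fin (J + 1)) (R : Finset (Fin M)) (w : W) (j : ClockInfo M L C),
    G.Finish e q hLC (v, i, k) R w j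

/-- The position `y` arises from `x` by one tick. -/
def Tick (G : IntervalParityGame V M) (e : W ≃ V) (q : ℕ) (hLC : L ≤ C) {J : ℕ}
    (x y : TickPosition W M L C J) : Prop :=
  G.CanMove e q hLC J x.1 x.2.1 ∧ y.1 = x.1 ∧ y.2.1 = x.2.1 ∧
    (y.2.2 : ℕ) = min ((x.2.2 : ℕ) + 1) J

end IntervalParityGame

theorem natCast_ereal_nonneg (k : ℕ) : (0 : EReal) ≤ k := by exact_mod_cast Nat.zero_le k

/-- The label without constraints, with the duration `k` and the set `R` of variables to reset. -/
noncomputable def unitLabel {M : ℕ} (k : ℕ) (R : Finset (Fin M)) : TransLabel M where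
  time := ⟨k, k, true, true⟩
  time_lo_nonneg := natCast_ereal_nonneg k
  time_hi_nonneg := natCast_ereal_nonneg k
  constr _ := ⟨⊥, ⊤, true, true⟩
  reset := R

theorem time_unitLabel {M : ℕ} (k : ℕ) (R : Finset (Fin M)) :
    (unitLabel k R).time.toSet = {(k : EReal)} := by
  ext x
  simp only [unitLabel, ExtInterval.toSet, Set.mem_ofPred_eq, Set.mem_singleton_iff, implies_true,
    and_true]
  exact ⟨fun h => le_antisymm h.2 h.1, fun h => ⟨h.ge, h.le⟩⟩

theorem constr_unitLabel {M : ℕ} (k : ℕ) (R : Finset (Fin M)) (i : Fin M) (x : EReal) :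
    x ∈ ((unitLabel k R).constr i).toSet := by
  simp [unitLabel, ExtInterval.toSet]

theorem isOverInt_unitLabel {M : ℕ} (k : ℕ) (R : Finset (Fin M)) :
    (unitLabel k R).time.IsOverInt ∧ ∀ i, ((unitLabel k R).constr i).IsOverInt := by
  have : IsExtInt (k : EReal) := Or.inr (Or.inr ⟨k, by simp⟩)
  exact ⟨⟨this, this⟩, fun i => ⟨Or.inl rfl, Or.inr (Or.inl rfl)⟩⟩

namespace IntervalParityGame

variable {V W : Type*} {M : ℕ} {L C : ℤ}

open scoped Classical in
/-- The counter-reset game that simulates `G`, where one unit of time of `G` becomes `q` ticks. A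
player waits tick by tick before finishing a move; waiting forever is losing. -/
noncomputable def discretize (G : IntervalParityGame V M) (e : W ≃ V) (q : ℕ) (hLC : L ≤ C)
    (J : ℕ) : IntervalParityGame (TickPosition W M L C J) M where
  owner x := G.owner (e x.1)
  edge _ _ := True
  label x y :=
    ((Finset.univ.filter fun R => y.2.2 = 0 ∧ G.Finish e q hLC x R y.1 y.2.1).image
      (unitLabel 0)) ∪ if G.Tick e q hLC x y then {unitLabel 1 ∅} else ∅
  coeff _ _ := 1
  payVar x := G.payVar (e x.1)
  -- Counters are always finite, so an infinite reading is known only to the position, and the whole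
  -- payoff moves into the additive constant.
  payMul x := if x.2.1.1 (G.payVar (e x.1)) then 0 else G.payMul (e x.1)
  payAdd x := (q : EReal) * if x.2.1.1 (G.payVar (e x.1))
    then G.payMul (e x.1) * ⊤ + G.payAdd (e x.1) else G.payAdd (e x.1)
  maxPrio := 2 * G.maxPrio + 2
  -- Waiting is odd for Player 0 and even for Player 1, hence losing for the one who waits, and
  -- exceeds every priority of `G`.
  prio x := if x.2.2 = 0 then (G.prio (e x.1)).castLE (by omega)
    else if G.owner (e x.1) = 0 then ⟨2 * G.maxPrio + 1, by omega⟩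
    else ⟨2 * G.maxPrio + 2, by omega⟩

section discretize

variable (G : IntervalParityGame V M) (e : W ≃ V) (q : ℕ) (hLC : L ≤ C) (J : ℕ)

theorem mem_label_discretize {x y : TickPosition W M L C J} {l : TransLabel M} :
    l ∈ (G.discretize e q hLC J).label x y ↔
      (∃ R, (y.2.2 = 0 ∧ G.Finish e q hLC x R y.1 y.2.1) ∧ unitLabel 0 R = l) ∨
        (G.Tick e q hLC x y ∧ l = unitLabel 1 ∅) := by
  classical
  simp only [discretize, Finset.mem_union, Finset.mem_image, Finset.mem_filter, Finset.mem_univ,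
    true_and]
  refine or_congr Iff.rfl ?_
  split_ifs with h <;> simp [h]

theorem isCounterReset_discretize : (G.discretize e q hLC J).IsCounterReset := by
  refine ⟨fun _ _ => rfl, fun x y _ l hl => ?_⟩
  rcases (G.mem_label_discretize e q hLC J).1 hl with ⟨R, -, rfl⟩ | ⟨-, rfl⟩
  · exact ⟨fun i x => constr_unitLabel _ _ _ _, Or.inl (by rw [time_unitLabel]; simp)⟩
  · exact ⟨fun i x => constr_unitLabel _ _ _ _, Or.inr (by rw [time_unitLabel]; simp)⟩

theorem isOverInt_discretize (hint : G.IsOverInt) (hq : 0 < q) :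
    (G.discretize e q hLC J).IsOverInt := by
  refine ⟨fun x y _ l hl => ?_, fun x => ⟨?_, IsExtInt.natCast_mul ?_ hq⟩⟩
  · rcases (G.mem_label_discretize e q hLC J).1 hl with ⟨R, -, rfl⟩ | ⟨-, rfl⟩
    · exact isOverInt_unitLabel _ _
    · exact isOverInt_unitLabel _ _
  · simp only [discretize]
    split_ifs
    · exact IsExtInt.zero
    · exact (hint.2 _).1
  · split_ifs
    · exact (IsExtInt.mul_top _).add (hint.2 _).2
    · exact (hint.2 _).2

theorem mem_succ_discretize {x y : GState (TickPosition W M L C J) M} :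
    y ∈ (G.discretize e q hLC J).succ x ↔
      (∃ R, (y.1.2.2 = 0 ∧ G.Finish e q hLC x.1 R y.1.1 y.1.2.1) ∧
        y.2 = fun i => if i ∈ R then 0 else x.2 i) ∨
      (G.Tick e q hLC x.1 y.1 ∧ y.2 = fun i => x.2 i + 1) := by
  have key : ∀ (k : ℕ) (R : Finset (Fin M)),
      (unitLabel k R ∈ (G.discretize e q hLC J).label x.1 y.1 →
        ((G.discretize e q hLC J).Allows (unitLabel k R) x y ↔
          y.2 = fun i => if i ∈ R then 0 else x.2 i + k)) := by
    intro k R hl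
    constructor
    · rintro ⟨-, -, -, h0, t, ht, h1⟩
      rw [time_unitLabel, Set.mem_singleton_iff] at ht
      funext i
      split_ifs with hi
      · exact h0 i hi
      · rw [h1 i hi, ht]
        simp [discretize]
    · intro h
      refine ⟨trivial, hl, fun i => constr_unitLabel _ _ _ _, fun i hi => ?_, k, ?_, fun i hi => ?_⟩
      · have hi' : i ∈ R := hi
        simp [h, hi']
      · rw [time_unitLabel]
        rfl
      · have hi' : i ∉ R := hi
        simp [h, hi', discretize]
  constructor
  · rintro ⟨l, hl⟩
    rcases (G.mem_label_discretize e q hLC J).1 hl.2.1 with ⟨R, hR, rfl⟩ | ⟨hT, rfl⟩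
    · left
      rw [key 0 R hl.2.1] at hl
      exact ⟨R, hR, by simpa using hl⟩
    · right
      rw [key 1 ∅ hl.2.1] at hl
      exact ⟨hT, by simpa using hl⟩
  · rintro (⟨R, hR, h⟩ | ⟨hT, h⟩)
    · refine ⟨unitLabel 0 R, ?_⟩
      rw [key]
      · simpa using h
      · exact (G.mem_label_discretize e q hLC J).2 (Or.inl ⟨R, hR, rfl⟩)
    · refine ⟨unitLabel 1 ∅, ?_⟩
      rw [key]
      · simpa using h
      · exact (G.mem_label_discretize e q hLC J).2 (Or.inr ⟨hT, rfl⟩)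

/-- The state `s` of `G` and the state `x` of the discretized game come from the same clock
configuration, some ticks before in the case of `x`. -/
def TickRel (s : GState V M) (x : GState (TickPosition W M L C J) M) : Prop :=
  ∃ (c : ClockConfig M) (k : ℕ), c.Valid L ∧ s = (e x.1.1, c.value q) ∧ x.1.2.1 = c.info hLC ∧
    (x.1.2.2 : ℕ) = min k J ∧ (k ≠ 0 → G.CanMove e q hLC J x.1.1 x.1.2.1) ∧
    x.2 = fun i => (((c.floor i + k : ℤ) : ℝ) : EReal)

end discretize

/-- The numbers `q`, `L`, `C`, `J` are adequate for the discretization of `G`. -/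
structure Adequate (G : IntervalParityGame V M) (q : ℕ) (L C : ℤ) (J : ℕ) : Prop where
  flat : G.IsFlat
  overInt : G.IsOverInt
  q_pos : 0 < q
  L_nonpos : L ≤ 0
  J_pos : 0 < J
  C_sub_le : C - L ≤ J
  constr_lt : ∃ B : ℤ, q * B < C ∧ ∀ v w, G.edge v w → ∀ l ∈ G.label v w, ∀ i, ∀ k : ℤ,
    ((l.constr i).lo = ((k : ℝ) : EReal) → k ≤ B) ∧ ((l.constr i).hi = ((k : ℝ) : EReal) → k ≤ B)
  time_lt : ∃ B : ℤ, q * B < J ∧ ∀ v w, G.edge v w → ∀ l ∈ G.label v w, ∀ k : ℤ,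
    (l.time.lo = ((k : ℝ) : EReal) → k ≤ B) ∧ (l.time.hi = ((k : ℝ) : EReal) → k ≤ B)

namespace Adequate

variable {G : IntervalParityGame V M} {q : ℕ} {J : ℕ} (e : W ≃ V) (hLC : L ≤ C)

/-- `Finish` is witnessed by some configuration of the region; by region invariance the move is
available from the actual one, with the actual number of ticks. -/
theorem exists_succ_of_finish (hG : G.Adequate q L C J) {x : TickPosition W M L C J}
    {R : Finset (Fin M)} {w : W} {j : ClockInfo M L C} (hx : G.Finish e q hLC x R w j)
    {c : ClockConfig M} (hc : c.Valid L) (hi : x.2.1 = c.info hLC) {k : ℕ}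
    (hk : (x.2.2 : ℕ) = min k J) :
    ∃ d : Delay, d.Valid ∧ d.ticks = k ∧ (c.next d R).info hLC = j ∧
      (e w, (c.next d R).value q) ∈ G.succ (e x.1, c.value q) := by
  obtain ⟨c', d', l, hc', hd', hi', hk', ⟨h1, h2, h3, h4⟩, rfl, rfl⟩ := hx
  obtain ⟨hl₁, hl₂⟩ := hG.overInt.1 _ _ h1 l h2
  obtain ⟨d, hd, hdk, hdi, hdur⟩ := ClockConfig.exists_delay hc' hc (hi'.trans hi) hd'
    hG.C_sub_le (hk'.trans hk)
  refine ⟨d, hd, hdk, (hdi _).symm, (G.succ_value hG.flat hG.q_pos hc _ _).2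
    ⟨d, l, hd, ⟨h1, h2, fun i => ?_, ?_⟩, rfl⟩⟩
  · obtain ⟨B, hB, hB'⟩ := hG.constr_lt
    have hb := hB' _ _ h1 l h2 i
    exact (ClockConfig.value_mem_iff hc' hc (hi'.trans hi) (hl₂ i) hG.q_pos
      (fun k => (hb k).1) (fun k => (hb k).2) hB i).1 (h3 i)
  · obtain ⟨B, hB, hB'⟩ := hG.time_lt
    have hb := hB' _ _ h1 l h2
    exact (hdur _ hl₁ B q hG.q_pos (fun k => (hb k).1) (fun k => (hb k).2) hB).1 h4

theorem canMove_iff (hG : G.Adequate q L C J) {c : ClockConfig M} (hc : c.Valid L) (v : W) :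
    G.CanMove e q hLC J v (c.info hLC) ↔ (G.succ (e v, c.value q)).Nonempty := by
  constructor
  · rintro ⟨k, R, w, j, hF⟩
    obtain ⟨d, -, -, -, h⟩ := hG.exists_succ_of_finish e hLC hF hc rfl (k := k)
      (min_eq_left (Nat.lt_succ_iff.1 k.2)).symm
    exact ⟨_, h⟩
  · rintro ⟨s, hs⟩
    obtain ⟨d, l, hd, hE, -⟩ := (G.succ_value hG.flat hG.q_pos hc _ _).1 hs
    refine ⟨⟨min d.ticks J, by omega⟩, l.reset, e.symm s.1, _, c, d, l, hc, hd, rfl, rfl, ?_, rfl,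
      rfl⟩
    rwa [e.apply_symm_apply]

/-- A delay is carried out as its number of ticks followed by the finishing step; `n` ticks are
still to come after `k`. -/
theorem reach_of_succ (hG : G.Adequate q L C J) {c : ClockConfig M} (hc : c.Valid L) {v : W}
    {d : Delay} (hd : d.Valid) {l : TransLabel M} {w : W} (hE : G.Enabled q (e v) (e w) c d l)
    (n k : ℕ) (hk : k + n = d.ticks) {x : GState (TickPosition W M L C J) M} (hv : x.1.1 = v)
    (hi : x.1.2.1 = c.info hLC) (hx : (x.1.2.2 : ℕ) = min k J)
    (hY : x.2 = fun i => (((c.floor i + k : ℤ) : ℝ) : EReal)) :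
    (G.discretize e q hLC J).graph.Reach (fun x => x.1.2.2 = 0) (G.TickRel e q hLC J) n x
      (e w, (c.next d l.reset).value q) := by
  subst hv
  induction n generalizing k x with
  | zero =>
    have hfin : G.Finish e q hLC x.1 l.reset w ((c.next d l.reset).info hLC) :=
      ⟨c, d, l, hc, hd, hi.symm, by rw [hx, ← hk]; rfl, hE, rfl, rfl⟩
    refine ⟨((w, (c.next d l.reset).info hLC, 0), fun i => if i ∈ l.reset then 0 else x.2 i),
      (G.mem_succ_discretize e q hLC J).2 (Or.inl ⟨l.reset, ⟨rfl, hfin⟩, rfl⟩), rfl,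
      c.next d l.reset, 0, hc.next hG.L_nonpos hd _, rfl, rfl, by simp, fun h => (h rfl).elim, ?_⟩
    funext i
    have hk' : k = d.ticks := by omega
    by_cases hi : i ∈ l.reset <;> simp [ClockConfig.next, hi, hY, hk']
  | succ n ih =>
    have hcan : G.CanMove e q hLC J x.1.1 x.1.2.1 := by
      rw [hi, hG.canMove_iff e hLC hc]
      exact ⟨_, (G.succ_value hG.flat hG.q_pos hc _ (e w, _)).2 ⟨d, l, hd, hE, rfl⟩⟩
    have hlt : min (k + 1) J < J + 1 := by omega
    refine ⟨((x.1.1, x.1.2.1, ⟨min (k + 1) J, hlt⟩), fun i => x.2 i + 1),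
      (G.mem_succ_discretize e q hLC J).2 (Or.inr ⟨⟨hcan, rfl, rfl, ?_⟩, rfl⟩), ?_, ?_⟩
    · change min (k + 1) J = _
      rw [hx]
      omega
    · have := hG.J_pos
      intro h
      refine absurd (congrArg Fin.val h) ?_
      change min (k + 1) J ≠ 0
      omega
    · refine ih (k + 1) (by omega) hi rfl ?_ hE
      funext i
      simp only [hY]
      rw [← EReal.coe_one, ← EReal.coe_add]
      congr 1
      push_cast
      ring

theorem stutterBisim (hG : G.Adequate q L C J) :
    G.graph.StutterBisim (G.discretize e q hLC J).graph (fun x => x.1.2.2 = 0)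
      (G.TickRel e q hLC J) := by
  have hback : ∀ {s x y}, G.TickRel e q hLC J s x → y ∈ (G.discretize e q hLC J).succ x →
      y.1.2.2 = 0 → ∃ t ∈ G.succ s, G.TickRel e q hLC J t y := by
    rintro s x y ⟨c, k, hc, rfl, hi, hk, -, hY⟩ hy hm
    rcases (G.mem_succ_discretize e q hLC J).1 hy with ⟨R, ⟨-, hF⟩, h⟩ | ⟨hT, -⟩
    · obtain ⟨d, hd, hdk, hdi, hs⟩ := hG.exists_succ_of_finish e hLC hF hc hi hk
      refine ⟨_, hs, c.next d R, 0, hc.next hG.L_nonpos hd R, rfl, hdi.symm, by simp [hm],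
        fun h => (h rfl).elim, ?_⟩
      rw [h, hY]
      funext i
      by_cases hi : i ∈ R <;> simp [ClockConfig.next, hi, hdk]
    -- A tick cannot lead into `main`, because `0 < J` keeps the clamped count positive.
    · have := hT.2.2.2
      have := hG.J_pos
      rw [hm, Fin.val_zero] at *
      omega
  have hcan : ∀ {s x}, G.TickRel e q hLC J s x →
      (G.CanMove e q hLC J x.1.1 x.1.2.1 ↔ (G.succ s).Nonempty) := by
    rintro s x ⟨c, k, hc, rfl, hi, -⟩
    rw [hi]
    exact hG.canMove_iff e hLC hc _
  refine ⟨?_, fun {s x} hR => ⟨?_, fun hs => ?_⟩, ?_, hback, ?_⟩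
  · rintro s x ⟨c, k, hc, rfl, -⟩
    rfl
  · rintro ⟨y, hy⟩
    rcases (G.mem_succ_discretize e q hLC J).1 hy with ⟨R, ⟨hm, -⟩, -⟩ | ⟨hT, -⟩
    · obtain ⟨t, ht, -⟩ := hback hR hy hm
      exact ⟨t, ht⟩
    · exact (hcan hR).1 hT.1
  · exact ⟨((x.1.1, x.1.2.1, ⟨min ((x.1.2.2 : ℕ) + 1) J, by omega⟩), fun i => x.2 i + 1),
      (G.mem_succ_discretize e q hLC J).2 (Or.inr ⟨⟨(hcan hR).2 hs, rfl, rfl, rfl⟩, rfl⟩)⟩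
  · rintro s x y ⟨c, k, hc, rfl, hi, hk, -, hY⟩ hy hm
    rcases (G.mem_succ_discretize e q hLC J).1 hy with ⟨R, ⟨h0, -⟩, -⟩ | ⟨⟨hT, h1, h2, h3⟩, h4⟩
    · exact (hm h0).elim
    · refine ⟨c, k + 1, hc, by rw [h1], by rw [h2, hi], by rw [h3, hk]; omega,
        fun _ => by rwa [h1, h2], ?_⟩
      rw [h4, hY]
      funext i
      rw [← EReal.coe_one, ← EReal.coe_add]
      congr 1
      push_cast
      ring
  · rintro s x t ⟨c, k, hc, rfl, hi, hk, -, hY⟩ hm ht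
    obtain ⟨d, l, hd, hE, h⟩ := (G.succ_value hG.flat hG.q_pos hc _ _).1 ht
    have hk0 : k = 0 := by
      have := hG.J_pos
      rw [hm, Fin.val_zero] at hk
      omega
    subst hk0
    have : t = (e (e.symm t.1), (c.next d l.reset).value q) :=
      Prod.ext (e.apply_symm_apply _).symm h
    rw [this]
    exact ⟨d.ticks, hG.reach_of_succ e hLC hc hd (by rwa [e.apply_symm_apply]) d.ticks 0
      (by omega) rfl hi hk hY⟩

end Adequate

end IntervalParityGame

/-! ### The error of the payoffs and the choice of constants. -/

theorem ExtClose.refl (x : EReal) {ε : ℝ} (hε : 0 ≤ ε) : ExtClose x x ε := by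
  have : x ≤ x + (ε : EReal) := le_add_of_nonneg_right (by exact_mod_cast hε)
  exact ⟨this, this⟩

theorem ExtClose.coe {x y ε : ℝ} (h : |x - y| ≤ ε) : ExtClose (x : EReal) (y : EReal) ε := by
  obtain ⟨h1, h2⟩ := abs_le.1 h
  rw [ExtClose, ← EReal.coe_add, ← EReal.coe_add, EReal.coe_le_coe_iff, EReal.coe_le_coe_iff]
  constructor <;> linarith

theorem natCast_mul_div_natCast (x : EReal) {q : ℕ} (hq : 0 < q) :
    (q : EReal) * x / (q : EReal) = x := by
  have hq' : (0 : ℝ) < q := by exact_mod_cast hq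
  induction x with
  | bot =>
    rw [show (q : EReal) * ⊥ = ⊥ from EReal.coe_mul_bot_of_pos hq', bot_div_natCast hq]
  | top =>
    rw [show (q : EReal) * ⊤ = ⊤ from EReal.coe_mul_top_of_pos hq', top_div_natCast hq]
  | coe x =>
    rw [show (q : EReal) = ((q : ℝ) : EReal) from rfl, ← EReal.coe_mul, ← EReal.coe_div]
    congr 1
    field_simp

/-- For finite `β` the difference is `a * δ / (n * m)`; for infinite `β` both sides are equal to
`β`. -/
theorem extClose_payoff {n m : ℕ} (hn : 0 < n) (hm : 0 < m) {a z δ : ℝ} (ha : |a| ≤ m)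
    (hδ : |δ| ≤ 1) (β : EReal) :
    ExtClose ((a : EReal) * (((z + δ) / (n * m : ℕ) : ℝ) : EReal) + β)
      (((a : EReal) * (z : EReal) + ((n * m : ℕ) : EReal) * β) / ((n * m : ℕ) : EReal))
      (1 / (n : ℝ)) := by
  have hq : 0 < n * m := Nat.mul_pos hn hm
  have hq' : (0 : ℝ) < (n * m : ℕ) := by exact_mod_cast hq
  have hε : (0 : ℝ) ≤ 1 / n := by positivity
  rw [← EReal.coe_mul, ← EReal.coe_mul]
  induction β with
  | bot =>
    rw [show ((n * m : ℕ) : EReal) * ⊥ = ⊥ from EReal.coe_mul_bot_of_pos hq', EReal.add_bot,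
      EReal.add_bot, bot_div_natCast hq]
    exact ExtClose.refl _ hε
  | top =>
    rw [show ((n * m : ℕ) : EReal) * ⊤ = ⊤ from EReal.coe_mul_top_of_pos hq', EReal.coe_add_top,
      EReal.coe_add_top, top_div_natCast hq]
    exact ExtClose.refl _ hε
  | coe β =>
    rw [show ((n * m : ℕ) : EReal) = (((n * m : ℕ) : ℝ) : EReal) from rfl, ← EReal.coe_mul,
      ← EReal.coe_add, ← EReal.coe_add, ← EReal.coe_div]
    refine ExtClose.coe ?_
    have e : a * ((z + δ) / (n * m : ℕ)) + β - (a * z + (n * m : ℕ) * β) / (n * m : ℕ) =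
        a * δ / (n * m : ℕ) := by
      field_simp
      ring
    rw [e, abs_div, abs_mul, abs_of_pos hq', div_le_div_iff₀ hq' (by exact_mod_cast hn)]
    have h1 : |a| * |δ| ≤ m * 1 := mul_le_mul ha hδ (abs_nonneg _) (by positivity)
    have h2 : (0 : ℝ) ≤ n := by positivity
    push_cast
    nlinarith

namespace IntervalParityGame

variable {V W : Type*} {M : ℕ} {L C : ℤ}

theorem Adequate.simulation {G : IntervalParityGame V M} {n m J : ℕ}
    (hG : G.Adequate (n * m) L C J) (e : W ≃ V) (hLC : L ≤ C) (hn : 0 < n) (hm : 0 < m)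
    (hmul : ∀ v, ∃ a : ℝ, G.payMul v = a ∧ |a| ≤ m) :
    G.Simulation (G.discretize e (n * m) hLC J) (fun x => x.1.2.2 = 0)
      (G.TickRel e (n * m) hLC J) (n * m) (1 / (n : ℝ)) where
  bisim := hG.stutterBisim e hLC
  payoff := by
    rintro s x ⟨c, k, hc, rfl, hi, -, hcan, hY⟩ hs
    -- Ticking requires a possible move, so no tick has passed in a state without successors and the
    -- counters equal the floors.
    have hk : k = 0 := by
      by_contra hk
      have := hcan hk
      rw [hi, hG.canMove_iff e hLC hc, hs] at this
      exact Set.not_nonempty_empty this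
    have hinf : ∀ i, x.1.2.1.1 i = c.infinite i := fun i => by rw [hi]; rfl
    subst hk
    simp only [payoff, discretize, hY]
    by_cases h : c.infinite (G.payVar (e x.1.1))
    · rw [if_pos (hinf _ ▸ h), if_pos (hinf _ ▸ h), ClockConfig.value_of_infinite h, zero_mul, zero_add,
        natCast_mul_div_natCast _ hG.q_pos]
      exact ExtClose.refl _ (by positivity)
    · obtain ⟨a, ha, ham⟩ := hmul (e x.1.1)
      rw [if_neg (hinf _ ▸ h), if_neg (hinf _ ▸ h), ClockConfig.value_of_not_infinite h, ha]
      have h1 := hc.now_mem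
      have h2 := hc.stamp_mem (G.payVar (e x.1.1))
      have hδ : |c.now - c.stamp (G.payVar (e x.1.1))| ≤ 1 := by
        rw [abs_le]
        constructor <;> linarith
      simpa using extClose_payoff hn hm ham hδ (G.payAdd (e x.1.1))
        (z := c.floor (G.payVar (e x.1.1)))
  prio_main := by
    rintro s x ⟨c, k, hc, rfl, -⟩ hx
    simp [discretize, hx]
  prio_wait := by
    intro s x _ hx
    simp only [discretize, if_neg hx]
    split_ifs <;> simp <;> omega
  even_prio_wait := by
    intro s x _ hx
    simp only [discretize, if_neg hx]
    split_ifs with h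
    · simp [h]
    · simp only [Nat.even_add, even_two_mul]
      simp
      omega

theorem exists_time_bound [Finite V] (G : IntervalParityGame V M) :
    ∃ B : ℤ, ∀ v w, ∀ l ∈ G.label v w, ∀ k : ℤ,
      (l.time.lo = ((k : ℝ) : EReal) → k ≤ B) ∧ (l.time.hi = ((k : ℝ) : EReal) → k ≤ B) := by
  have hfin : (⋃ v, ⋃ w, ⋃ l ∈ G.label v w,
      ({⌊l.time.lo.toReal⌋, ⌊l.time.hi.toReal⌋} : Set ℤ)).Finite :=
    Set.finite_iUnion fun v => Set.finite_iUnion fun w =>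
      (G.label v w).finite_toSet.biUnion fun l _ => Set.toFinite _
  obtain ⟨B, hB⟩ := hfin.bddAbove
  refine ⟨B, fun v w l hl k => ⟨fun h => hB ?_, fun h => hB ?_⟩⟩ <;>
  · simp only [Set.mem_iUnion]
    exact ⟨v, w, l, hl, by simp [h]⟩

theorem exists_adequate [Finite V] (G : IntervalParityGame V M) (hflat : G.IsFlat)
    (hint : G.IsOverInt) {b : ℕ} (hb : G.ConstraintsBoundedBy b) {q : ℕ} (hq : 0 < q)
    (hL : L ≤ 0) : ∃ J, G.Adequate q L (q * (b + 1)) J := by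
  obtain ⟨B, hB⟩ := G.exists_time_bound
  -- The last two summands dominate `C - L` and the scaled time endpoints; the 1 makes `J` positive
  -- and the second bound strict.
  refine ⟨1 + (q * (b + 1) - L).toNat + (q * B).toNat,
    hflat, hint, hq, hL, by omega, by omega,
    ⟨b, by nlinarith, fun v w he l hl i k => ?_⟩, ⟨B, by omega, fun v w _ => hB v w⟩⟩
  have key : ∀ z : EReal, z = ⊤ ∨ z ≤ (b : EReal) → z = ((k : ℝ) : EReal) → k ≤ b := by
    rintro z h rfl
    rcases h with h | h
    · exact (EReal.coe_ne_top _ h).elim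
    · have h' : ((k : ℝ) : EReal) ≤ ((b : ℝ) : EReal) := h
      exact_mod_cast EReal.coe_le_coe_iff.1 h'
  obtain ⟨h1, h2⟩ := hb v w he l hl i
  exact ⟨key _ h1, key _ h2⟩

end IntervalParityGame

/-! ### The theorem. -/

/-- The configuration at an integer instant with finite integral readings. -/
def ClockConfig.ofInt {M : ℕ} (y : Fin M → ℤ) : ClockConfig M where
  floor := y
  infinite _ := False
  now := 0
  stamp _ := 0

theorem mainTheorem4 {V : Type*} [Finite V] {M : ℕ} (G : IntervalParityGame V M)
    (hflat : G.IsFlat) (hint : G.IsOverInt)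
    (m : ℕ) (hm : IsGreatest (Set.range fun v => (G.payMul v).abs) (m : ENNReal))
    (hm_pos : 0 < m)
    (b : ℕ) (hb : G.ConstraintsBoundedBy b)
    (n : ℕ) (hn : 0 < n) (N : ℕ) :
    ∃ (V' : Type) (_ : Finite V') (G' : IntervalParityGame V' M)
      (κ : V → (Fin M → ℤ) → V'),
      G'.IsCounterReset ∧ G'.IsOverInt ∧
      ∀ (v : V) (y : Fin M → ℤ), (∀ i, -(N : ℤ) ≤ y i) →
        ExtClose (G.lowerVal (v, intValuation 1 y))
          (G'.lowerVal (κ v (fun i => min (y i) ((b : ℤ) + 1)), intValuation (n * m) y)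
            / ((n * m : ℕ) : EReal)) (1 / (n : ℝ)) ∧
        ExtClose (G.upperVal (v, intValuation 1 y))
          (G'.upperVal (κ v (fun i => min (y i) ((b : ℤ) + 1)), intValuation (n * m) y)
            / ((n * m : ℕ) : EReal)) (1 / (n : ℝ)) := by
  have hq : 0 < n * m := Nat.mul_pos hn hm_pos
  have hq' : (0 : ℝ) < (n * m : ℕ) := by exact_mod_cast hq
  have hL : -((n * m : ℕ) * N : ℤ) ≤ 0 := neg_nonpos.2 (by positivity)
  have hLC : -((n * m : ℕ) * N : ℤ) ≤ (n * m : ℕ) * (b + 1) := hL.trans (by positivity)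
  have hmul : ∀ v, ∃ a : ℝ, G.payMul v = a ∧ |a| ≤ m := by
    intro v
    have h : (G.payMul v).abs ≤ m := hm.2 ⟨v, rfl⟩
    generalize G.payMul v = x at h
    induction x with
    | bot => simp at h
    | top => simp at h
    | coe a =>
      refine ⟨a, rfl, ?_⟩
      rw [EReal.abs_def, ← ENNReal.ofReal_natCast,
        ENNReal.ofReal_le_ofReal_iff (Nat.cast_nonneg m)] at h
      exact h
  obtain ⟨J, hG⟩ := G.exists_adequate hflat hint hb hq hL
  -- The new positions have to live in `Type`, whatever the universe of `V`.
  let e : Fin (Nat.card V) ≃ V := (Finite.equivFin V).symm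
  refine ⟨IntervalParityGame.TickPosition (Fin (Nat.card V)) M _ _ J, inferInstance,
    G.discretize e (n * m) hLC J,
    fun v y => (e.symm v, (ClockConfig.ofInt fun i => (n * m : ℕ) * y i).info hLC, 0),
    G.isCounterReset_discretize _ _ _ _, G.isOverInt_discretize _ _ _ _ hint hq,
    fun v y hy => ?_⟩
  have hsim := hG.simulation e hLC hn hm_pos hmul
  have hrel : G.TickRel e (n * m) hLC J (v, intValuation 1 y)
      ((e.symm v, (ClockConfig.ofInt fun i => (n * m : ℕ) * min (y i) ((b : ℤ) + 1)).info hLC, 0),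
        intValuation (n * m) y) := by
    refine ⟨ClockConfig.ofInt fun i => (n * m : ℕ) * y i, 0,
      ⟨fun i => ?_, by simp [ClockConfig.ofInt], by simp [ClockConfig.ofInt]⟩, ?_, ?_, by simp,
      fun h => (h rfl).elim, ?_⟩
    · have := mul_le_mul_of_nonneg_left (hy i) (Int.natCast_nonneg (n * m))
      simp only [ClockConfig.ofInt]
      linarith
    · refine Prod.ext (e.apply_symm_apply v).symm (funext fun i => ?_)
      refine Eq.trans ?_ (ClockConfig.value_of_not_infinite (by simp [ClockConfig.ofInt]) _).symm
      simp only [intValuation, ClockConfig.ofInt]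
      congr 1
      push_cast at hq' ⊢
      field_simp
      ring
    -- Replacing `y i` by `min (y i) (b + 1)` does not change the region, since floors are clamped
    -- at `C = q * (b + 1)` anyway and all fractional parts are 0.
    · refine Prod.ext rfl (Prod.ext (funext fun i => Subtype.ext ?_) ?_)
      · simp only [ClockConfig.info, ClockConfig.ofInt, Set.coe_projIcc]
        rw [mul_min_of_nonneg _ _ (Int.natCast_nonneg (n * m)), min_comm, min_assoc, min_self,
          min_comm]
      · funext a c
        rcases a with _ | _ | i <;> rcases c with _ | _ | j <;> rfl
    · funext i
      simp [intValuation, ClockConfig.ofInt]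
  exact ⟨hsim.extClose_lowerVal hq hrel rfl, hsim.extClose_upperVal hq hrel rfl⟩
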